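/- **Setting.** Let $\Omega\subset\mathbb R^d$ be compact and convex, and let $\mathsf G=(\mathsf V,\mathsf E,l)$ be a finite metric graph with oriented edges $e=(v,w)$ of lengths $l_e>0$, embedded in $\Omega$: there are distinct points $x_v\in\Omega$ $(v\in\mathsf V)$ with $|x_w-x_v|=l_e$ for $e=(v,w)$, and the straight edges $[x_v,x_w]$ (again denoted $e$) meet at most in common vertices. Let $\mathsf E(v)$ be the set of edges containing $v$, $\mathsf V_{\rm out}=\{v:|\mathsf E(v)|=1\}$, $n_e^v=-1$ if $e=(v,w)$ and $n_e^v=+1$ if $e=(w,v)$. On $e=(v,w)$ put $\tau_e=(x_w-x_v)/l_e$ and write $\partial_{\tau_e}$ for the derivative in the direction $\tau_e$. Initial and final data are finite non-negative Borel measures $\mu_k$ on $\Omega$ and $\rho_k=(\rho_k^e)_{e\in\mathsf E}$ on the edges with $\mu_k(\Omega)+\sum_e\rho_k^e(e)=1$, $k=0,1$. **Weak solutions.** $\mathsf{CE}(\mathsf G)$ is the set of tuples of Borel measurable families, indexed by $t\in[0,1]$, of finite signed or vector measures $\mu_t$ on $\Omega$ (values in $\mathbb R$), $J_t$ on $\Omega$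 (values in $\mathbb R^d$), $\rho_t=(\rho_t^e)_e$, $V_t=(\tau_e\mathcal V_t^e)_e$, $f_t=(f_t^e)_e$ on the edges ($\rho^e_t,\mathcal V^e_t,f^e_t$ real-valued), and $G_t=(\tau_e\mathcal G_t^e(x_v))$ on the points $\{x_v\}$, $v\in\mathsf V_{\rm out}$, $e\in\mathsf E(v)$, all with total variation integrable over $t\in[0,1]$, such that for all $\phi\in C^1([0,1]\times\Omega)$ (restrictions of $C^1$ functions on $\mathbb R\times\mathbb R^d$) $$\int_0^1\!\!\int_\Omega\partial_t\phi_t\,d\mu_tdt+\int_0^1\!\!\int_\Omega\nabla\phi_t\cdot dJ_tdt-\sum_{e}\int_0^1\!\!\int_e\phi_t\,df_t^edt+\sum_{v\in\mathsf V_{\rm out}}\sum_{e\in\mathsf E(v)}\int_0^1\!\!\int_{\{x_v\}}\phi_t\,n_e^v\,d\mathcal G_t^e(x_v)dt=\int_\Omega\phi_1\,d\mu_1-\int_\Omega\phi_0\,d\mu_0,$$ and for all $\psi=(\psi^e)_e$ with $\psi^e\in C^1([0,1]\times e)$ whose values agree at common vertices $$\sum_e\int_0^1\!\!\Big(\int_e\partial_t\psi_t^e\,d\rho_t^e+\int_e\partial_{\tau_e}\psi_t^e\,d\mathcal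 V_t^e+\int_e\psi_t^e\,df_t^e\Big)dt-\sum_{v\in\mathsf V_{\rm out}}\sum_{e\in\mathsf E(v)}\int_0^1\!\!\int_{\{x_v\}}\psi_t^e\,n_e^v\,d\mathcal G_t^e(x_v)dt=\sum_e\Big(\int_e\psi_1^e\,d\rho_1^e-\int_e\psi_0^e\,d\rho_0^e\Big).$$ **Action.** An admissible mobility is an upper semicontinuous concave function $m:[0,\infty)\to[0,\infty)\cup\{-\infty\}$ such that the interior of $\mathrm{dom}(m)=\{m>-\infty\}$ is a bounded interval $(a,b)$, $0\le a<b<\infty$, with $m>0$ on $(a,b)$. For an admissible mobility $m$ put $\Psi_m(u,v)=|v|^2/m(u)$ if $u\ge 0$ and $m(u)>0$; $\Psi_m(u,v)=0$ if $u\ge 0$, $m(u)=0$ and $v=0$; and $\Psi_m(u,v)=+\infty$ otherwise, in particular if $u\notin\mathrm{dom}(m)$. Fix admissible mobilities $m_\Omega,m_{\mathsf G}$, constants $\alpha_1,\alpha_2,\alpha_3>0$ and finite non-negative Borel measures $\lambda_\Omega$ on $\Omega$, $\lambda_e$ on $e$, $\lambda_v$ on $\{x_v\}$. Put $$\mathcal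 A_{\mathsf G}=\int_\Omega\Psi_{m_\Omega}\Big(\tfrac{d\mu_t}{d\lambda_\Omega},\tfrac{dJ_t}{d\lambda_\Omega}\Big)d\lambda_\Omega+\sum_e\int_e\Big(\alpha_1\Psi_{m_{\mathsf G}}\Big(\tfrac{d\rho_t^e}{d\lambda_e},\tfrac{d\mathcal V_t^e}{d\lambda_e}\Big)+\alpha_2\Psi_{m_{\mathsf G}}\Big(\tfrac{d\rho_t^e}{d\lambda_e},\tfrac{df_t^e}{d\lambda_e}\Big)\Big)d\lambda_e+\alpha_3\sum_{v\in\mathsf V_{\rm out}}\sum_{e\in\mathsf E(v)}\int_{\{x_v\}}\Psi_{m_{\mathsf G}}\Big(\tfrac{d\rho_t^e|_{x_v}}{d\lambda_v},\tfrac{d\mathcal G_t^e(x_v)}{d\lambda_v}\Big)d\lambda_v .$$ The total action is $\int_0^1\mathcal A_{\mathsf G}\,dt$ if for almost every $t$ one has $\mu_t,J_t\ll\lambda_\Omega$, $\rho_t^e,\mathcal V_t^e,f_t^e\ll\lambda_e$ for all $e$, and $\rho_t^e|_{x_v},\mathcal G_t^e(x_v)\ll\lambda_v$ for all $v\in\mathsf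 V_{\rm out}$, $e\in\mathsf E(v)$; otherwise it is $+\infty$. **Theorem.** If the infimum of the total action over $\mathsf{CE}(\mathsf G)$ (which is $+\infty$ if $\mathsf{CE}(\mathsf G)$ is empty) is finite, then it is attained: there is a tuple $(\mu_t,J_t,\rho_t,V_t,f_t,G_t)\in\mathsf{CE}(\mathsf G)$ whose total action equals this infimum. -/

import Mathlib

open MeasureTheory Set
open scoped ENNReal NNReal Gradient

noncomputable section

/-- Points of `ℝ^d` (with the Euclidean norm). -/
abbrev Pt (d : ℕ) : Type := EuclideanSpace ℝ (Fin d)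

/-! ### Metric graphs and their embeddings -/

/-- A metric graph: oriented edges `e = (v, w)` between vertices in `V`, each with a positive
length. -/
structure MetricGraph (V : Type*) where
  edges : Finset (V × V)
  len : {e : V × V // e ∈ edges} → ℝ
  len_pos : ∀ e, 0 < len e

namespace MetricGraph

variable {V : Type*} (G : MetricGraph V)

/-- The type of edges. -/
abbrev Edge : Type _ := {e : V × V // e ∈ G.edges}

variable {G}

/-- The starting vertex `v` of `e = (v, w)`. -/
def src (e : G.Edge) : V := e.1.1

/-- The end vertex `w` of `e = (v, w)`. -/
def tgt (e : G.Edge) : V := e.1.2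

/-- The vertex `v` is an end point of the edge `e`. -/
def Incident (v : V) (e : G.Edge) : Prop := src e = v ∨ tgt e = v

variable (G) in
/-- Outer vertices: those contained in exactly one edge. -/
def IsOuter (v : V) : Prop := Nat.card {e : G.Edge // Incident v e} = 1

variable (G) in
/-- Pairs `(v, e)` of an outer vertex `v` and an edge `e` containing it. -/
def OuterEnd : Type _ := {p : V × G.Edge // G.IsOuter p.1 ∧ Incident p.1 p.2}

/-- The vertex of an outer end. -/
def OuterEnd.vertex (p : G.OuterEnd) : V := p.1.1

/-- The edge of an outer end. -/
def OuterEnd.edge (p : G.OuterEnd) : G.Edge := p.1.2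

instance [Finite V] : Fintype G.OuterEnd :=
  have : Finite G.OuterEnd := by unfold OuterEnd; infer_instance
  Fintype.ofFinite _

open Classical in
/-- The outer normal `n_e^v`: `-1` if `e = (v, w)`, `+1` if `e = (w, v)`, and `0` if `v ∉ e`. -/
def normal (v : V) (e : G.Edge) : ℝ :=
  if src e = v then -1 else if tgt e = v then 1 else 0

variable {d : ℕ}

/-- The straight edge `[x_v, x_w]` in `ℝ^d` that belongs to `e = (v, w)`. -/
def edgeSegment (x : V → Pt d) (e : G.Edge) : Set (Pt d) := segment ℝ (x (src e)) (x (tgt e))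

/-- The coordinate map `y ↦ |y - x_v| / l_e` from the edge `e = [x_v, x_w]` to `[0,1]`. -/
def coord (x : V → Pt d) (e : G.Edge) (y : Pt d) : ℝ := ‖y - x (src e)‖ / G.len e

variable (G) in
/-- The points `x v` embed the metric graph `G` into `Ω`: they are distinct points of `Ω`, the
straight edges have the prescribed lengths, and two different edges meet at most in common
vertices. -/
structure IsEmbedded (Ω : Set (Pt d)) (x : V → Pt d) : Prop where
  injective : Function.Injective x
  mem : ∀ v, x v ∈ Ω
  len_eq : ∀ e : G.Edge, ‖x (tgt e) - x (src e)‖ = G.len e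
  inter : ∀ e e' : G.Edge, e ≠ e' → ∀ y ∈ edgeSegment x e ∩ edgeSegment x e',
    ∃ v, Incident v e ∧ Incident v e' ∧ y = x v

end MetricGraph

open MetricGraph

/-! ### Admissible mobilities and the integrand of the action -/

/-- Admissible mobilities: upper semicontinuous concave functions
`m : [0, ∞) → [0, ∞) ∪ {-∞}` whose domain `{m > -∞}` has as its interior a bounded interval
`(a, b)`, `0 ≤ a < b`, on which `m` is positive. -/
structure IsAdmissibleMobility (m : ℝ≥0 → EReal) : Prop where
  values : ∀ z, m z = ⊥ ∨ (0 ≤ m z ∧ m z < ⊤)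
  usc : UpperSemicontinuous m
  concave : ∀ u v s t : ℝ≥0, s + t = 1 →
    ((s : ℝ) : EReal) * m u + ((t : ℝ) : EReal) * m v ≤ m (s * u + t * v)
  interior_dom : ∃ a b : ℝ, 0 ≤ a ∧ a < b ∧
    interior {z : ℝ | ∃ h : 0 ≤ z, m ⟨z, h⟩ ≠ ⊥} = Ioo a b ∧
    ∀ z : ℝ≥0, (z : ℝ) ∈ Ioo a b → 0 < m z

open Classical in
/-- The integrand `Ψ(u, v)`: it is `|v|² / m(u)` if `0 < m(u)`, it is `0` if `m(u) = 0` and `v = 0`,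
and `+∞` otherwise (in particular if `u` is outside the domain of `m`, i.e. if `u < 0` or
`m(u) = -∞`). -/
def Psi {F : Type*} [NormedAddCommGroup F] (m : ℝ≥0 → EReal) (u : ℝ) (v : F) : ℝ≥0∞ :=
  if 0 ≤ u ∧ 0 < m u.toNNReal then ENNReal.ofReal (‖v‖ ^ 2 / (m u.toNNReal).toReal)
  else if 0 ≤ u ∧ m u.toNNReal = 0 ∧ v = 0 then 0
  else ⊤

/-! ### Families of measures

Measures on a compact set `U ⊆ ℝ^d` are represented by (signed, vector-valued) Borel measures on
`ℝ^d` that are concentrated on `U`. -/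

/-- A Borel measurable family, indexed by `t ∈ [0,1]`, of finite measures on `U` with values in `F`.
Its total mass is integrable in time, so that all space-time integrals against it make sense. -/
structure IsMeasureFamily {d : ℕ} {F : Type*} [NormedAddCommGroup F] [MeasurableSpace F]
    (U : Set (Pt d)) (ν : unitInterval → VectorMeasure (Pt d) F) : Prop where
  concentrated : ∀ t A, MeasurableSet A → Disjoint A U → ν t A = 0
  measurable : ∀ A, MeasurableSet A → Measurable fun t => ν t A
  integrable : ∫⁻ t, (ν t).variation univ < ⊤

/-- The density `dJ / dl` of an `ℝ^d`-valued measure, taken in each coordinate. -/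
def vectorDensity {d : ℕ} (J : VectorMeasure (Pt d) (Pt d)) (l : Measure (Pt d)) (y : Pt d) :
    Pt d :=
  WithLp.toLp 2 fun i => SignedMeasure.rnDeriv
    (J.mapRange (EuclideanSpace.proj i : Pt d →L[ℝ] ℝ).toLinearMap.toAddMonoidHom
      (EuclideanSpace.proj i : Pt d →L[ℝ] ℝ).continuous) l y

/-! ### The coupled system -/

section

variable {V : Type*} {d : ℕ}

/-- The tuples `(μ_t, J_t, ρ_t, V_t, f_t, G_t)`. A measure on the graph is given by its parts on the
edges. The tangential measures `V_t^e = τ_e 𝒱_t^e` and `G_t^e(x_v) = τ_e 𝒢_t^e(x_v)` are given by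
their scalar representatives, the fields `flux` and `exchange`. -/
structure Tuple (G : MetricGraph V) (d : ℕ) where
  mu : unitInterval → SignedMeasure (Pt d)
  J : unitInterval → VectorMeasure (Pt d) (Pt d)
  rho : unitInterval → G.Edge → SignedMeasure (Pt d)
  flux : unitInterval → G.Edge → SignedMeasure (Pt d)
  f : unitInterval → G.Edge → SignedMeasure (Pt d)
  exchange : unitInterval → G.OuterEnd → SignedMeasure (Pt d)

/-- Pairs of non-negative measures `(μ, ρ)` on `Ω` and on the graph with total mass one. -/
structure IsAdmissibleData {G : MetricGraph V} (Ω : Set (Pt d)) (x : V → Pt d)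
    (μ : Measure (Pt d)) (ρ : G.Edge → Measure (Pt d)) : Prop where
  mu_concentrated : μ Ωᶜ = 0
  rho_concentrated : ∀ e, ρ e (edgeSegment x e)ᶜ = 0
  mass : μ univ + ∑ e, ρ e univ = 1

/-- The space of admissible tuples of Borel families of measures. -/
structure IsAdmissibleTuple {G : MetricGraph V} (Ω : Set (Pt d)) (x : V → Pt d)
    (T : Tuple G d) : Prop where
  mu : IsMeasureFamily Ω T.mu
  J : IsMeasureFamily Ω T.J
  rho : ∀ e, IsMeasureFamily (edgeSegment x e) fun t => T.rho t e
  flux : ∀ e, IsMeasureFamily (edgeSegment x e) fun t => T.flux t e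
  f : ∀ e, IsMeasureFamily (edgeSegment x e) fun t => T.f t e
  exchange : ∀ p, IsMeasureFamily {x p.vertex} fun t => T.exchange t p

/-- The weak continuity equation in the bulk. The test functions in `C¹([0,1] × Ω)` are the
restrictions of `C¹` functions on `ℝ × ℝ^d`. -/
def BulkEquation [Finite V] {G : MetricGraph V} (x : V → Pt d) (μ₀ μ₁ : Measure (Pt d))
    (T : Tuple G d) : Prop :=
  ∀ φ : ℝ → Pt d → ℝ, ContDiff ℝ 1 (fun z : ℝ × Pt d => φ z.1 z.2) →
    (∫ t : unitInterval, ∫ᵛ y, deriv (fun r => φ r y) t ∂•(T.mu t))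
      + (∫ t : unitInterval, ∫ᵛ y, ∇ (φ t) y ∂[innerSL ℝ; T.J t])
      - (∑ e : G.Edge, ∫ t : unitInterval, ∫ᵛ y, φ t y ∂•(T.f t e))
      + (∑ p : G.OuterEnd, ∫ t : unitInterval,
          ∫ᵛ _y, φ t (x p.vertex) * normal p.vertex p.edge ∂•(T.exchange t p))
    = (∫ y, φ 1 y ∂μ₁) - ∫ y, φ 0 y ∂μ₀

/-- The weak continuity equations on the edges, coupled at the vertices. The test functions
`ψ e t s`, `s ∈ [0,1]`, are `C¹` on each edge and continuous at the vertices; integrals over `[0,1]`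
against measures transported by `coord x e` are written as integrals over the edge. Since
`s = coord x e y` is arc length divided by `l_e`, the tangential derivative of `ψ e` along the edge
is `l_e⁻¹ ∂_s (ψ e)`. -/
def GraphEquation [Finite V] {G : MetricGraph V} (x : V → Pt d) (ρ₀ ρ₁ : G.Edge → Measure (Pt d))
    (T : Tuple G d) : Prop :=
  ∀ ψ : G.Edge → ℝ → ℝ → ℝ, (∀ e, ContDiff ℝ 1 (fun z : ℝ × ℝ => ψ e z.1 z.2)) →
    (∃ ψV : V → ℝ → ℝ, ∀ e, ∀ t ∈ Icc (0 : ℝ) 1,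
      ψ e t 0 = ψV (src e) t ∧ ψ e t 1 = ψV (tgt e) t) →
    (∑ e : G.Edge,
      ((∫ t : unitInterval, ∫ᵛ y, deriv (fun r => ψ e r (coord x e y)) t ∂•(T.rho t e))
        + (∫ t : unitInterval,
            ∫ᵛ y, (G.len e)⁻¹ * deriv (ψ e t) (coord x e y) ∂•(T.flux t e))
        + (∫ t : unitInterval, ∫ᵛ y, ψ e t (coord x e y) ∂•(T.f t e))))
      - (∑ p : G.OuterEnd, ∫ t : unitInterval,
          ∫ᵛ _y, ψ p.edge t (coord x p.edge (x p.vertex)) * normal p.vertex p.edge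
            ∂•(T.exchange t p))
    = ∑ e : G.Edge, ((∫ y, ψ e 1 (coord x e y) ∂(ρ₁ e)) - ∫ y, ψ e 0 (coord x e y) ∂(ρ₀ e))

/-- The set `CE(G)` of weak solutions of the coupled continuity equations with the given initial
and final data. -/
def CE [Finite V] (G : MetricGraph V) (Ω : Set (Pt d)) (x : V → Pt d) (μ₀ μ₁ : Measure (Pt d))
    (ρ₀ ρ₁ : G.Edge → Measure (Pt d)) : Set (Tuple G d) :=
  {T | IsAdmissibleTuple Ω x T ∧ BulkEquation x μ₀ μ₁ T ∧ GraphEquation x ρ₀ ρ₁ T}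

/-! ### The action and the dynamic transport problem -/

/-- The data of the action: mobilities, cost parameters and reference measures. -/
structure CostData (G : MetricGraph V) (d : ℕ) where
  mobBulk : ℝ≥0 → EReal
  mobGraph : ℝ≥0 → EReal
  α₁ : ℝ
  α₂ : ℝ
  α₃ : ℝ
  lamBulk : Measure (Pt d)
  lamEdge : G.Edge → Measure (Pt d)
  lamVertex : V → Measure (Pt d)

/-- Admissible mobilities, positive parameters, and finite reference measures on `Ω`, on the edges
and on the points `x_v`. -/
structure CostData.IsAdmissible {G : MetricGraph V} (C : CostData G d) (Ω : Set (Pt d))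
    (x : V → Pt d) : Prop where
  mobBulk : IsAdmissibleMobility C.mobBulk
  mobGraph : IsAdmissibleMobility C.mobGraph
  α₁_pos : 0 < C.α₁
  α₂_pos : 0 < C.α₂
  α₃_pos : 0 < C.α₃
  lamBulk_finite : IsFiniteMeasure C.lamBulk
  lamEdge_finite : ∀ e, IsFiniteMeasure (C.lamEdge e)
  lamVertex_finite : ∀ v, IsFiniteMeasure (C.lamVertex v)
  lamBulk_concentrated : C.lamBulk Ωᶜ = 0
  lamEdge_concentrated : ∀ e, C.lamEdge e (edgeSegment x e)ᶜ = 0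
  lamVertex_concentrated : ∀ v, C.lamVertex v {x v}ᶜ = 0

/-- At time `t`, the measures of the tuple are absolutely continuous with respect to the reference
measures. -/
structure AbsContAt {G : MetricGraph V} (C : CostData G d) (x : V → Pt d) (T : Tuple G d)
    (t : unitInterval) : Prop where
  mu : T.mu t ≪ᵥ C.lamBulk.toENNRealVectorMeasure
  J : T.J t ≪ᵥ C.lamBulk.toENNRealVectorMeasure
  rho : ∀ e, T.rho t e ≪ᵥ (C.lamEdge e).toENNRealVectorMeasure
  flux : ∀ e, T.flux t e ≪ᵥ (C.lamEdge e).toENNRealVectorMeasure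
  f : ∀ e, T.f t e ≪ᵥ (C.lamEdge e).toENNRealVectorMeasure
  rho_vertex : ∀ p : G.OuterEnd,
    (T.rho t p.edge).restrict {x p.vertex} ≪ᵥ (C.lamVertex p.vertex).toENNRealVectorMeasure
  exchange : ∀ p : G.OuterEnd,
    T.exchange t p ≪ᵥ (C.lamVertex p.vertex).toENNRealVectorMeasure

/-- The action at time `t`, through the densities with respect to the reference measures. -/
def action [Finite V] {G : MetricGraph V} (C : CostData G d) (x : V → Pt d) (T : Tuple G d)
    (t : unitInterval) : ℝ≥0∞ :=
  (∫⁻ y, Psi C.mobBulk ((T.mu t).rnDeriv C.lamBulk y) (vectorDensity (T.J t) C.lamBulk y)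
      ∂C.lamBulk)
  + (∑ e : G.Edge, ∫⁻ y,
      (ENNReal.ofReal C.α₁ * Psi C.mobGraph ((T.rho t e).rnDeriv (C.lamEdge e) y)
          ((T.flux t e).rnDeriv (C.lamEdge e) y)
        + ENNReal.ofReal C.α₂ * Psi C.mobGraph ((T.rho t e).rnDeriv (C.lamEdge e) y)
          ((T.f t e).rnDeriv (C.lamEdge e) y)) ∂(C.lamEdge e))
  + ENNReal.ofReal C.α₃ * ∑ p : G.OuterEnd, ∫⁻ y,
      Psi C.mobGraph
        (SignedMeasure.rnDeriv ((T.rho t p.edge).restrict {x p.vertex}) (C.lamVertex p.vertex) y)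
        ((T.exchange t p).rnDeriv (C.lamVertex p.vertex) y) ∂(C.lamVertex p.vertex)

open Classical in
/-- The time integral of the action; it is `+∞` for tuples that are not absolutely continuous with
respect to the reference measures for almost every time. -/
def totalAction [Finite V] {G : MetricGraph V} (C : CostData G d) (x : V → Pt d) (T : Tuple G d) :
    ℝ≥0∞ :=
  if ∀ᵐ t : unitInterval, AbsContAt C x T t then ∫⁻ t : unitInterval, action C x T t else ⊤

/-- The value of the coupled bulk-graph dynamic transport problem. -/
def valueBB [Finite V] (G : MetricGraph V) (C : CostData G d) (Ω : Set (Pt d)) (x : V → Pt d)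
    (μ₀ μ₁ : Measure (Pt d)) (ρ₀ ρ₁ : G.Edge → Measure (Pt d)) : ℝ≥0∞ :=
  ⨅ T ∈ CE G Ω x μ₀ μ₁ ρ₀ ρ₁, totalAction C x T

end

end

noncomputable section

open MetricGraph Filter Topology
open scoped RealInnerProductSpace

/-! The direct method, carried out on densities in a Hilbert space. The domain of an admissible
mobility is bounded and the mobility is bounded on it, so `|u|² + |v|² ≤ (M + 1) Ψ(u, v) + b²`
(`exists_growth`). Hence a tuple of finite action has square integrable densities in space and time,
and is encoded by one element `z` of `L²([0,1]; ⨁ₖ L²(lₖ))`, where `k` runs over the scalar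
components of the tuple. The part of `ρ` at an outer vertex is a component of its own, since its
reference measure differs from that of the edge.

In this encoding both sides of the problem are simple. The test functions are continuous and the
reference measures live on compact sets, so each weak equation is a continuous linear functional of
`z` set equal to a constant. Together with the linear compatibility of `ρ` and its vertex parts,
they cut out a closed convex set, and each of its points is the density of some weak solution
(`exists_closed_convex_densities`). The action becomes the time integral of `actionFunctional`. It
is convex because `m` is concave, strongly lower semicontinuous because `m` is upper semicontinuous
(with Fatou's lemma), and it controls the square of the norm. Its sublevel sets are therefore
closed, convex and bounded, and nested nonempty sets of this kind intersect (`exists_minimizer`).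

The delicate point is measurability. The tuple only provides that `t ↦ ν_t(A)` is measurable, while
`z` must be strongly measurable with values in a Hilbert space. Countably many sets `A` separate
signed measures, so the evaluations on them embed the separable density space injectively and
continuously into a countable product of lines; by Lusin–Souslin the inverse is measurable on the
range (`DensitySpace.exists_measurable_density`). -/

/-- Convexity of a functional with values in `[0, ∞]`. -/
def ENNRealConvex {H : Type*} [AddCommGroup H] [Module ℝ H] (F : H → ℝ≥0∞) : Prop :=
  ∀ x y (s t : ℝ≥0), s + t = 1 → F ((s : ℝ) • x + (t : ℝ) • y) ≤ s * F x + t * F y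

/-- Quadratic growth of a functional with values in `[0, ∞]`. -/
def QuadraticGrowth {H : Type*} [NormedAddCommGroup H] (F : H → ℝ≥0∞) : Prop :=
  ∃ A B : ℝ≥0, ∀ x, ‖x‖ₑ ^ 2 ≤ A * F x + B

lemma ENNRealConvex.convex_sublevel {H : Type*} [AddCommGroup H] [Module ℝ H] {F : H → ℝ≥0∞}
    (hF : ENNRealConvex F) (c : ℝ≥0∞) : Convex ℝ {x | F x ≤ c} := by
  intro x hx y hy a b ha hb hab
  lift a to ℝ≥0 using ha
  lift b to ℝ≥0 using hb
  have h1 : a + b = 1 := by exact_mod_cast hab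
  refine (hF x y a b h1).trans ?_
  calc (a : ℝ≥0∞) * F x + b * F y ≤ a * c + b * c := by gcongr; exacts [hx, hy]
    _ = c := by rw [← add_mul, ← ENNReal.coe_add, h1]; simp

/-- This plays the role of weak compactness. The points of minimal norm in the sets `K n` have
increasing, bounded norms, and the parallelogram law turns convergence of the norms into convergence
of the points. -/
lemma nonempty_iInter_of_antitone_closed_convex {H : Type*} [NormedAddCommGroup H]
    [InnerProductSpace ℝ H] [CompleteSpace H] {K : ℕ → Set H} (hK : Antitone K)
    (hne : ∀ n, (K n).Nonempty) (hcl : ∀ n, IsClosed (K n)) (hconv : ∀ n, Convex ℝ (K n))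
    {R : ℝ} (hR : ∀ n, ∀ x ∈ K n, ‖x‖ ≤ R) : (⋂ n, K n).Nonempty := by
  have hmin : ∀ n, ∃ y ∈ K n, ∀ z ∈ K n, ‖y‖ ≤ ‖z‖ := by
    intro n
    obtain ⟨y, hy, h⟩ := exists_norm_eq_iInf_of_complete_convex (hne n) (hcl n).isComplete
      (hconv n) 0
    refine ⟨y, hy, fun z hz => ?_⟩
    have := ciInf_le (f := fun w : K n => ‖(0 : H) - w‖) ⟨0, by rintro _ ⟨w, rfl⟩; positivity⟩
      ⟨z, hz⟩
    rw [← h] at this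
    simpa using this
  choose y hy hymin using hmin
  have hmono : Monotone fun n => ‖y n‖ := fun n m h => hymin n _ (hK h (hy m))
  have hbdd : BddAbove (range fun n => ‖y n‖) := ⟨R, by rintro _ ⟨n, rfl⟩; exact hR n _ (hy n)⟩
  have hlim := tendsto_atTop_ciSup hmono hbdd
  set L := ⨆ n, ‖y n‖
  have hle : ∀ n, ‖y n‖ ≤ L := fun n => le_ciSup hbdd n
  -- Both points lie in `K n`, hence so does their midpoint, whose norm is at least `‖y n‖`.
  have hdist : ∀ n m, n ≤ m → ‖y n - y m‖ ^ 2 ≤ 2 * (L ^ 2 - ‖y n‖ ^ 2) := by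
    intro n m h
    have hmid : ‖y n‖ ≤ ‖(2⁻¹ : ℝ) • y n + (2⁻¹ : ℝ) • y m‖ :=
      hymin n _ (hconv n (hy n) (hK h (hy m)) (by norm_num) (by norm_num) (by norm_num))
    rw [← smul_add, norm_smul] at hmid
    have hp := parallelogram_law_with_norm ℝ (y n) (y m)
    have h2 : ‖(2⁻¹ : ℝ)‖ = 2⁻¹ := by norm_num
    rw [h2] at hmid
    have h3 := hle m
    have h4 := norm_nonneg (y m)
    have h5 := norm_nonneg (y n)
    nlinarith
  have hcau : CauchySeq y := by
    refine cauchySeq_of_le_tendsto_0' (fun n => √(2 * (L ^ 2 - ‖y n‖ ^ 2))) (fun n m h => ?_) ?_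
    · rw [dist_eq_norm]
      exact Real.le_sqrt_of_sq_le (hdist n m h)
    · have : Tendsto (fun n => √(2 * (L ^ 2 - ‖y n‖ ^ 2))) atTop (𝓝 √(2 * (L ^ 2 - L ^ 2))) :=
        ((tendsto_const_nhds.sub (hlim.pow 2)).const_mul 2).sqrt
      simpa using this
  obtain ⟨x, hx⟩ := cauchySeq_tendsto_of_complete hcau
  refine ⟨x, mem_iInter.2 fun n => ?_⟩
  exact (hcl n).mem_of_tendsto hx
    ((eventually_ge_atTop n).mono fun m hm => hK hm (hy m))

/-- The direct method for convex functionals on a Hilbert space. -/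
theorem exists_minimizer {H : Type*} [NormedAddCommGroup H] [InnerProductSpace ℝ H]
    [CompleteSpace H] {S : Set H} (hS : IsClosed S) (hSc : Convex ℝ S) {F : H → ℝ≥0∞}
    (hF : LowerSemicontinuous F) (hFc : ENNRealConvex F) (hFq : QuadraticGrowth F)
    (hfin : ∃ x ∈ S, F x < ⊤) : ∃ x ∈ S, ∀ y ∈ S, F x ≤ F y := by
  obtain ⟨A, B, hAB⟩ := hFq
  set c := ⨅ y : S, F y
  obtain ⟨x₀, hx₀, hx₀fin⟩ := hfin
  have hc : c < ⊤ := (iInf_le (fun y : S => F y) ⟨x₀, hx₀⟩).trans_lt hx₀fin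
  let δ : ℕ → ℝ≥0∞ := fun n => ((n : ℝ≥0∞) + 1)⁻¹
  have hδ : Antitone δ := fun n m h => ENNReal.inv_le_inv.2 (by gcongr)
  have hδ0 : ∀ n, 0 < δ n := fun n => ENNReal.inv_pos.2 (by finiteness)
  have hδ1 : ∀ n, δ n ≤ 1 := fun n => ENNReal.inv_le_one.2 (by simp)
  -- The near-minimizers up to `δ n`; a point common to all `K n` attains the infimum `c`.
  let K : ℕ → Set H := fun n => S ∩ {x | F x ≤ c + δ n}
  have hne : ∀ n, (K n).Nonempty := by
    intro n
    have : ⨅ y : S, F y < c + δ n := ENNReal.lt_add_right hc.ne (hδ0 n).ne'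
    obtain ⟨y, hy⟩ := iInf_lt_iff.1 this
    exact ⟨y, y.2, hy.le⟩
  have hR : ∀ n, ∀ x ∈ K n, ‖x‖ ≤ √((A * (c + 1) + B).toReal) := by
    intro n x hx
    refine Real.le_sqrt_of_sq_le ?_
    have hfin : (A : ℝ≥0∞) * (c + 1) + B ≠ ⊤ := by
      have := hc.ne
      finiteness
    have h1 : ‖x‖ₑ ^ 2 ≤ A * (c + 1) + B := by
      refine (hAB x).trans ?_
      gcongr
      exact hx.2.trans (by gcongr; exact hδ1 n)
    have := ENNReal.toReal_mono hfin h1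
    simpa using this
  obtain ⟨x, hx⟩ := nonempty_iInter_of_antitone_closed_convex
    (fun n m h => inter_subset_inter_right _ fun x (hx : F x ≤ c + δ m) =>
      hx.trans (by gcongr; exact hδ h))
    hne (fun n => hS.inter (hF.isClosed_preimage _)) (fun n => hSc.inter (hFc.convex_sublevel _)) hR
  rw [mem_iInter] at hx
  refine ⟨x, (hx 0).1, fun y hy => ?_⟩
  refine le_trans ?_ (iInf_le (fun y : S => F y) ⟨y, hy⟩)
  have hlim : Tendsto (fun n => c + δ n) atTop (𝓝 (c + 0)) := by
    refine Tendsto.const_add _ ?_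
    have := (tendsto_add_atTop_iff_nat (f := fun n : ℕ => (n : ℝ≥0∞)⁻¹) 1).2
      ENNReal.tendsto_inv_nat_nhds_zero
    simpa [δ] using this
  rw [add_zero] at hlim
  exact ge_of_tendsto' hlim fun n => (hx n).2

/-! ### Integral functionals on Lebesgue spaces of vector-valued functions. -/

section IntegralFunctional

variable {T E : Type*} [MeasurableSpace T] {ν : Measure T} [NormedAddCommGroup E]
  {Φ : E → ℝ≥0∞}

lemma LowerSemicontinuous.aemeasurable_comp (hΦ : LowerSemicontinuous Φ) {f : T → E}
    (hf : AEStronglyMeasurable f ν) : AEMeasurable (fun t => Φ (f t)) ν := by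
  borelize E
  exact hΦ.measurable.comp_aemeasurable hf.aemeasurable

/-- A sequence converging in `L^p` has a subsequence converging almost everywhere, along which
Fatou's lemma applies. Strong lower semicontinuity is enough, since convexity enters separately
through the sublevel sets. -/
lemma lowerSemicontinuous_lintegral_Lp {p : ℝ≥0∞} [Fact (1 ≤ p)] (hΦ : LowerSemicontinuous Φ) :
    LowerSemicontinuous fun z : Lp E p ν => ∫⁻ t, Φ (z t) ∂ν := by
  rw [lowerSemicontinuous_iff_isClosed_preimage]
  intro c
  refine IsSeqClosed.isClosed fun z w hz hzw => ?_
  obtain ⟨φ, -, hφ⟩ := (tendstoInMeasure_of_tendsto_Lp hzw).exists_seq_tendsto_ae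
  change ∫⁻ t, Φ (w t) ∂ν ≤ c
  calc ∫⁻ t, Φ (w t) ∂ν ≤ ∫⁻ t, liminf (fun n => Φ (z (φ n) t)) atTop ∂ν := by
        refine lintegral_mono_ae (hφ.mono fun t ht => ?_)
        exact (hΦ.le_liminf _).trans (liminf_le_liminf_of_le ht)
    _ ≤ liminf (fun n => ∫⁻ t, Φ (z (φ n) t) ∂ν) atTop :=
        lintegral_liminf_le' fun n => hΦ.aemeasurable_comp (Lp.aestronglyMeasurable _)
    _ ≤ c := by
        refine (liminf_le_liminf (v := fun _ => c) (Eventually.of_forall fun n => hz (φ n))).trans ?_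
        simp

lemma ENNRealConvex.lintegral_Lp [NormedSpace ℝ E] {p : ℝ≥0∞} (hΦ : LowerSemicontinuous Φ)
    (hc : ENNRealConvex Φ) : ENNRealConvex fun z : Lp E p ν => ∫⁻ t, Φ (z t) ∂ν := by
  intro z w s t hst
  have hm : ∀ z : Lp E p ν, AEMeasurable (fun t => Φ (z t)) ν :=
    fun z => hΦ.aemeasurable_comp (Lp.aestronglyMeasurable _)
  calc ∫⁻ a, Φ (((s : ℝ) • z + (t : ℝ) • w : Lp E p ν) a) ∂ν
      ≤ ∫⁻ a, (s * Φ (z a) + t * Φ (w a)) ∂ν := by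
        refine lintegral_mono_ae ?_
        filter_upwards [Lp.coeFn_add ((s : ℝ) • z) ((t : ℝ) • w), Lp.coeFn_smul (s : ℝ) z,
          Lp.coeFn_smul (t : ℝ) w] with a h1 h2 h3
        rw [h1, Pi.add_apply, h2, h3]
        exact hc _ _ _ _ hst
    _ = s * ∫⁻ a, Φ (z a) ∂ν + t * ∫⁻ a, Φ (w a) ∂ν := by
        rw [lintegral_add_left' ((hm z).const_mul _), lintegral_const_mul'' _ (hm z),
          lintegral_const_mul'' _ (hm w)]

lemma enorm_sq_Lp_two (z : Lp E 2 ν) : ‖z‖ₑ ^ 2 = ∫⁻ t, ‖z t‖ₑ ^ 2 ∂ν := by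
  rw [Lp.enorm_def, eLpNorm_eq_lintegral_rpow_enorm_toReal (by norm_num) (by norm_num),
    ← ENNReal.rpow_natCast, ← ENNReal.rpow_mul]
  simp

lemma QuadraticGrowth.lintegral_Lp [IsFiniteMeasure ν] (hΦ : LowerSemicontinuous Φ)
    (hq : QuadraticGrowth Φ) : QuadraticGrowth fun z : Lp E 2 ν => ∫⁻ t, Φ (z t) ∂ν := by
  obtain ⟨A, B, h⟩ := hq
  refine ⟨A, B * (ν univ).toNNReal, fun z => ?_⟩
  have hm : AEMeasurable (fun t => Φ (z t)) ν := hΦ.aemeasurable_comp (Lp.aestronglyMeasurable _)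
  rw [enorm_sq_Lp_two]
  calc ∫⁻ t, ‖z t‖ₑ ^ 2 ∂ν ≤ ∫⁻ t, (A * Φ (z t) + B) ∂ν := lintegral_mono fun t => h _
    _ = A * ∫⁻ t, Φ (z t) ∂ν + (B * (ν univ).toNNReal : ℝ≥0) := by
        rw [lintegral_add_right _ measurable_const, lintegral_const_mul'' _ hm]
        simp

end IntegralFunctional

/-! ### Mobilities: semicontinuity, convexity and growth of the integrand. -/

namespace IsAdmissibleMobility

variable {m : ℝ≥0 → EReal} (hm : IsAdmissibleMobility m)
include hm

lemma lt_top (z : ℝ≥0) : m z < ⊤ := by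
  rcases hm.values z with h | h
  · simp [h]
  · exact h.2

lemma coe_toReal {z : ℝ≥0} (h : m z ≠ ⊥) : ((m z).toReal : EReal) = m z :=
  EReal.coe_toReal (hm.lt_top z).ne h

lemma toReal_nonneg (z : ℝ≥0) : 0 ≤ (m z).toReal := by
  rcases hm.values z with h | h
  · simp [h]
  · exact EReal.toReal_nonneg h.1

lemma concave_ne_bot {u v : ℝ≥0} (hu : m u ≠ ⊥) (hv : m v ≠ ⊥) {s t : ℝ≥0} (hst : s + t = 1) :
    m (s * u + t * v) ≠ ⊥ ∧
      s * (m u).toReal + t * (m v).toReal ≤ (m (s * u + t * v)).toReal := by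
  have h := hm.concave u v s t hst
  rw [← hm.coe_toReal hu, ← hm.coe_toReal hv] at h
  have h' : ((s * (m u).toReal + t * (m v).toReal : ℝ) : EReal) ≤ m (s * u + t * v) := by
    exact_mod_cast h
  have hb : m (s * u + t * v) ≠ ⊥ := fun hb => by
    rw [hb] at h'
    exact EReal.coe_ne_bot _ (le_bot_iff.1 h')
  refine ⟨hb, ?_⟩
  rw [← hm.coe_toReal hb] at h'
  exact_mod_cast h'

/-- The domain of a mobility is bounded, and so is the mobility. -/
lemma exists_bounds : ∃ b M : ℝ≥0, ∀ z, m z ≠ ⊥ → z ≤ b ∧ (m z).toReal ≤ M := by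
  obtain ⟨a, b, ha, hab, hint, -⟩ := hm.interior_dom
  set D : Set ℝ := {z : ℝ | ∃ h : 0 ≤ z, m ⟨z, h⟩ ≠ ⊥}
  have hconv : Convex ℝ D := by
    rintro u ⟨hu0, hu⟩ v ⟨hv0, hv⟩ s t hs ht hst
    refine ⟨by simp only [smul_eq_mul]; positivity, ?_⟩
    exact (hm.concave_ne_bot hu hv (s := ⟨s, hs⟩) (t := ⟨t, ht⟩) (by ext; exact hst)).1
  have hle : ∀ z ∈ D, z ≤ b := by
    intro z hz
    by_contra! hbz
    have hmem : (a + b) / 2 ∈ interior D := by rw [hint]; constructor <;> linarith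
    -- A domain point `z` beyond `b` would make the open segment from the midpoint of `(a, b)` to
    -- `z` interior to the domain, and that segment contains `b`.
    have hb' : b ∈ interior D := by
      refine hconv.openSegment_interior_self_subset_interior hmem hz ?_
      rw [openSegment_eq_Ioo (by linarith)]
      constructor <;> linarith
    rw [hint] at hb'
    exact lt_irrefl _ hb'.2
  have hb0 : 0 ≤ b := ha.trans hab.le
  obtain ⟨z₀, -, hmax⟩ := (hm.usc.upperSemicontinuousOn (Icc 0 b.toNNReal)).exists_isMaxOn
    ⟨0, by simp⟩ isCompact_Icc
  refine ⟨b.toNNReal, (m z₀).toReal.toNNReal, fun z hz => ?_⟩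
  have hzb : z ≤ b.toNNReal := (Real.le_toNNReal_iff_coe_le hb0).2 (hle z ⟨z.2, hz⟩)
  refine ⟨hzb, ?_⟩
  have hle' : m z ≤ m z₀ := hmax ⟨zero_le, hzb⟩
  have hz₀ : m z₀ ≠ ⊥ := fun h => hz (le_bot_iff.1 (h ▸ hle'))
  rw [Real.coe_toNNReal _ (hm.toReal_nonneg _)]
  exact EReal.toReal_le_toReal hle' hz (hm.lt_top _).ne

variable {F : Type*} [NormedAddCommGroup F]

/-- Clearing the denominator merges the cases `m(u) > 0` and `m(u) = 0`: in the second, the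
inequality forces `v = 0`. Convexity and growth are read off from this form. -/
lemma Psi_le_iff {u : ℝ} {v : F} {c : ℝ≥0} :
    Psi m u v ≤ c ↔ 0 ≤ u ∧ m u.toNNReal ≠ ⊥ ∧ ‖v‖ ^ 2 ≤ c * (m u.toNNReal).toReal := by
  unfold Psi
  split_ifs with h1 h2
  · have hb : m u.toNNReal ≠ ⊥ := h1.2.ne_bot
    have hpos : 0 < (m u.toNNReal).toReal := EReal.toReal_pos h1.2 (hm.lt_top _).ne
    rw [ENNReal.ofReal_le_iff_le_toReal (by simp), div_le_iff₀ hpos]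
    simp [h1.1, hb]
  · simp [h2]
  · simp only [top_le_iff, ENNReal.coe_ne_top, false_iff, not_and, not_le]
    intro hu hb
    rcases hm.values u.toNNReal with h | h
    · exact absurd h hb
    · have h0 : m u.toNNReal = 0 := by
        by_contra h0
        exact h1 ⟨hu, lt_of_le_of_ne h.1 (Ne.symm h0)⟩
      have hv : v ≠ 0 := fun hv => h2 ⟨hu, h0, hv⟩
      simp [h0, hv]

lemma Psi_le_iff' {u : ℝ} {v : F} {c : ℝ≥0} (hc : 0 < c) :
    Psi m u v ≤ c ↔ 0 ≤ u ∧ ((‖v‖ ^ 2 / c : ℝ) : EReal) ≤ m u.toNNReal := by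
  rw [hm.Psi_le_iff]
  refine and_congr_right fun _ => ?_
  have hc' : (0 : ℝ) < c := hc
  constructor
  · rintro ⟨hb, h⟩
    rw [← hm.coe_toReal hb, EReal.coe_le_coe_iff, div_le_iff₀ hc']
    linarith
  · intro h
    have hb : m u.toNNReal ≠ ⊥ := fun hb => by
      rw [hb] at h
      exact EReal.coe_ne_bot _ (le_bot_iff.1 h)
    rw [← hm.coe_toReal hb, EReal.coe_le_coe_iff, div_le_iff₀ hc'] at h
    exact ⟨hb, by linarith⟩

lemma lowerSemicontinuous_Psi : LowerSemicontinuous fun p : ℝ × F => Psi m p.1 p.2 := by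
  intro p y hy
  obtain ⟨c, hyc, hcp⟩ := ENNReal.lt_iff_exists_nnreal_btwn.1 hy
  have hc : 0 < c := by
    have := zero_le.trans_lt hyc
    exact_mod_cast this
  -- For `c > 0` the sublevel set is, within `u ≥ 0`, the preimage of the hypograph of `m` under the
  -- continuous map `(u, v) ↦ (u, |v|²/c)`; the hypograph is closed because `m` is upper
  -- semicontinuous.
  have hcl : IsClosed {q : ℝ × F | Psi m q.1 q.2 ≤ c} := by
    simp only [hm.Psi_le_iff' hc, ofPred_and]
    refine (isClosed_le continuous_const continuous_fst).inter ?_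
    have hyp := ((upperSemicontinuousOn_iff_isClosed_hypograph isClosed_univ).1
      (hm.usc.upperSemicontinuousOn univ))
    have hcont : Continuous fun q : ℝ × F =>
        (q.1.toNNReal, ((‖q.2‖ ^ 2 / c : ℝ) : EReal)) := by
      refine (continuous_real_toNNReal.comp continuous_fst).prodMk ?_
      exact continuous_coe_real_ereal.comp (by fun_prop)
    have := hyp.preimage hcont
    simpa using this
  filter_upwards [hcl.isOpen_compl.mem_nhds (not_le.2 hcp)] with q hq
  exact hyc.trans (not_le.1 hq)

lemma Psi_convex [NormedSpace ℝ F] : ENNRealConvex fun p : ℝ × F => Psi m p.1 p.2 := by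
  rintro ⟨u, v⟩ ⟨u', v'⟩ s t hst
  -- Zero weights are treated apart because `0 * ⊤ = 0`; for positive weights an infinite value
  -- makes the right-hand side infinite.
  rcases eq_or_ne s 0 with rfl | hs
  · obtain rfl : t = 1 := by simpa using hst
    simp
  rcases eq_or_ne t 0 with rfl | ht
  · obtain rfl : s = 1 := by simpa using hst
    simp
  simp only [Prod.fst_add, Prod.smul_fst, Prod.snd_add, Prod.smul_snd, smul_eq_mul]
  rcases eq_or_ne (Psi m u v) ⊤ with h | h
  · simp [h, ENNReal.mul_top, hs]
  rcases eq_or_ne (Psi m u' v') ⊤ with h' | h'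
  · simp [h', ENNReal.mul_top, ht]
  lift Psi m u v to ℝ≥0 using h with c hc
  lift Psi m u' v' to ℝ≥0 using h' with c' hc'
  obtain ⟨hu, hb, hv⟩ := hm.Psi_le_iff.1 hc.ge
  obtain ⟨hu', hb', hv'⟩ := hm.Psi_le_iff.1 hc'.ge
  rw [← ENNReal.coe_mul, ← ENNReal.coe_mul, ← ENNReal.coe_add, hm.Psi_le_iff]
  have hN : (s * u + t * u').toNNReal = s * u.toNNReal + t * u'.toNNReal := by
    rw [Real.toNNReal_add (by positivity) (by positivity), Real.toNNReal_mul (by positivity),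
      Real.toNNReal_mul (by positivity)]
    simp
  obtain ⟨hB, hle⟩ := hm.concave_ne_bot hb hb' hst
  refine ⟨by positivity, by rwa [hN], ?_⟩
  rw [hN]
  have hM := hm.toReal_nonneg u.toNNReal
  have hM' := hm.toReal_nonneg u'.toNNReal
  set M := (m u.toNNReal).toReal
  set M' := (m u'.toNNReal).toReal
  have h1 : ‖(s : ℝ) • v + (t : ℝ) • v'‖ ≤ s * ‖v‖ + t * ‖v'‖ := by
    refine (norm_add_le _ _).trans (le_of_eq ?_)
    simp [norm_smul]
  -- The arithmetic-geometric mean inequality for `c M'` and `c' M`, whose product bounds `(‖v‖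
  -- ‖v'‖)²`. It makes `(s‖v‖ + t‖v'‖)²` at most `(s c + t c')(s M + t M')`.
  have h2 : ‖v‖ * ‖v'‖ * 2 ≤ c * M' + c' * M := by
    have hsq : (‖v‖ * ‖v'‖) ^ 2 ≤ (c * M) * (c' * M') := by
      rw [mul_pow]
      gcongr
    refine abs_le_of_sq_le_sq' ?_ (by positivity) |>.2
    nlinarith [sq_nonneg ((c : ℝ) * M' - c' * M)]
  have hs0 : (0 : ℝ) ≤ s := s.2
  have ht0 : (0 : ℝ) ≤ t := t.2
  calc ‖(s : ℝ) • v + (t : ℝ) • v'‖ ^ 2 ≤ (s * ‖v‖ + t * ‖v'‖) ^ 2 := by gcongr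
    _ = s ^ 2 * ‖v‖ ^ 2 + t ^ 2 * ‖v'‖ ^ 2 + s * t * (‖v‖ * ‖v'‖ * 2) := by ring
    _ ≤ s ^ 2 * (c * M) + t ^ 2 * (c' * M') + s * t * (c * M' + c' * M) := by gcongr
    _ = (s * c + t * c') * (s * M + t * M') := by ring
    _ ≤ ((s * c + t * c' : ℝ≥0) : ℝ) * (m (s * u.toNNReal + t * u'.toNNReal)).toReal := by
        push_cast
        gcongr

/-- Finite values of the integrand control its arguments quadratically. -/
lemma exists_growth : ∃ A B : ℝ≥0, ∀ (u : ℝ) (v : F),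
    ‖u‖ₑ ^ 2 + ‖v‖ₑ ^ 2 ≤ (A + 1) * Psi m u v + B := by
  obtain ⟨b, M, h⟩ := hm.exists_bounds
  -- `b` bounds the domain and `M` the mobility. The extra `1` in the factor `A + 1` keeps it
  -- nonzero, so that the bound is trivial when the integrand is infinite.
  refine ⟨M, b ^ 2, fun u v => ?_⟩
  rcases eq_or_ne (Psi m u v) ⊤ with ht | ht
  · rw [ht, ENNReal.mul_top (by simp)]
    simp
  lift Psi m u v to ℝ≥0 using ht with c hc
  obtain ⟨hu, hb, hv⟩ := hm.Psi_le_iff.1 hc.ge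
  obtain ⟨h1, h2⟩ := h _ hb
  have h3 : ‖u‖₊ ≤ b := by
    rwa [← Real.toNNReal_eq_nnnorm_of_nonneg hu]
  have h4 : ‖v‖₊ ^ 2 ≤ (M + 1) * c := by
    rw [← NNReal.coe_le_coe]
    push_cast
    have : (c : ℝ) * (m u.toNNReal).toReal ≤ c * M := by gcongr
    nlinarith [c.2]
  simp only [enorm_eq_nnnorm]
  norm_cast
  rw [add_comm]
  gcongr

end IsAdmissibleMobility

/-! ### Integrals against vector measures with a density -/

/-- The variation of the measure with density `w` is `‖w‖ l`, so the identity is proved for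
indicators and extended by linearity and `L¹`-density with respect to `‖w‖ l`. Statements that hold
almost everywhere for `‖w‖ l` say nothing where `w = 0`, but there the integrand `B (g y) (w y)`
vanishes. -/
theorem integral_withDensityᵥ {X E F G : Type*} [MeasurableSpace X]
    [NormedAddCommGroup E] [NormedSpace ℝ E] [NormedAddCommGroup F] [NormedSpace ℝ F]
    [CompleteSpace F] [NormedAddCommGroup G] [NormedSpace ℝ G] [CompleteSpace G]
    (B : E →L[ℝ] F →L[ℝ] G) {l : Measure X} {w : X → F} (hw : Integrable w l) {g : X → E}
    (hg : Integrable g (l.withDensity fun y => ‖w y‖ₑ)) :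
    (l.withDensityᵥ w).integral g B = ∫ y, B (g y) (w y) ∂l := by
  have hwm : AEMeasurable (fun y => ‖w y‖ₑ) l := hw.aestronglyMeasurable.enorm
  have hwfin : ∀ᵐ y ∂l, ‖w y‖ₑ < ⊤ := Eventually.of_forall fun y => enorm_lt_top
  have hvar := Measure.variation_withDensityᵥ hw
  have hBint : ∀ {f : X → E}, Integrable f (l.withDensity fun y => ‖w y‖ₑ) →
      Integrable (fun y => B (f y) (w y)) l := by
    intro f hf
    have h1 := (integrable_withDensity_iff_integrable_smul₀' hwm hwfin).1 hf
    obtain ⟨f', hf', hff'⟩ := hf.aestronglyMeasurable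
    rw [Filter.EventuallyEq, ae_withDensity_iff' hwm] at hff'
    have h2 : AEStronglyMeasurable (fun y => B (f y) (w y)) l := by
      refine AEStronglyMeasurable.congr
        (f := fun y => B (f' y) (w y)) ?_ ?_
      · exact B.aestronglyMeasurable_comp₂ hf'.aestronglyMeasurable hw.aestronglyMeasurable
      · filter_upwards [hff'] with y hy
        by_cases h : w y = 0
        · simp [h]
        · rw [hy (by simpa using h)]
    refine (h1.norm.const_mul ‖B‖).mono' h2 (Eventually.of_forall fun y => ?_)
    refine (B.le_opNorm₂ _ _).trans (le_of_eq ?_)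
    simp [norm_smul]
    ring
  have hint : ∀ {f : X → E}, Integrable f (l.withDensity fun y => ‖w y‖ₑ) →
      (l.withDensityᵥ w).Integrable f := by
    intro f hf
    rwa [VectorMeasure.Integrable, hvar]
  refine Integrable.induction (μ := l.withDensity fun y => ‖w y‖ₑ)
    (fun g => (l.withDensityᵥ w).integral g B = ∫ y, B (g y) (w y) ∂l) ?_ ?_ ?_ ?_ hg
  · intro c s hs hfin
    rw [VectorMeasure.integral_indicator hs]
    have : IsFiniteMeasure ((l.withDensityᵥ w).variation.restrict s) := ⟨by
      rw [Measure.restrict_apply_univ, hvar]; exact hfin⟩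
    rw [VectorMeasure.setIntegral_const, withDensityᵥ_apply hw hs,
      ← ContinuousLinearMap.integral_comp_comm _ hw.integrableOn, ← integral_indicator hs]
    congr 1 with y
    by_cases hy : y ∈ s <;> simp [hy]
  · intro f g _ hf hg h1 h2
    rw [VectorMeasure.integral_add (hint hf) (hint hg), h1, h2,
      ← integral_add (hBint hf) (hBint hg)]
    simp
  · have hc1 := VectorMeasure.continuous_integral (μ := l.withDensityᵥ w) (B := B)
    rw [hvar] at hc1
    refine isClosed_eq hc1 ?_
    refine continuous_iff_continuousAt.2 fun f => ?_
    rw [ContinuousAt, tendsto_iff_norm_sub_tendsto_zero]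
    refine squeeze_zero (fun _ => norm_nonneg _) (g := fun f' => ‖B‖ * ‖f' - f‖) (fun f' => ?_) ?_
    · rw [← integral_sub (hBint (L1.integrable_coeFn f')) (hBint (L1.integrable_coeFn f)),
        L1.norm_eq_integral_norm, integral_withDensity_eq_integral_toReal_smul₀ hwm hwfin,
        ← integral_const_mul]
      have hdiff := (Lp.coeFn_sub f' f)
      rw [Filter.EventuallyEq, ae_withDensity_iff' hwm] at hdiff
      have hi := (integrable_withDensity_iff_integrable_smul₀' hwm hwfin).1
        (L1.integrable_coeFn (f' - f)).norm
      refine norm_integral_le_of_norm_le (hi.const_mul ‖B‖) ?_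
      filter_upwards [hdiff] with y hy
      by_cases h : w y = 0
      · simp [h]
      · rw [hy (by simpa using h), ← _root_.sub_apply, ← map_sub]
        refine (B.le_opNorm₂ _ _).trans (le_of_eq ?_)
        simp
        ring
    · have : Tendsto (fun f' => ‖B‖ * ‖f' - f‖) (𝓝 f) (𝓝 (‖B‖ * ‖f - f‖)) := by
        refine Continuous.tendsto ?_ f
        fun_prop
      simpa using this
  · intro f g hfg _ h
    have hfg' : f =ᵐ[(l.withDensityᵥ w).variation] g := by rwa [hvar]
    rw [← VectorMeasure.integral_congr_ae hfg', h]
    rw [Filter.EventuallyEq, ae_withDensity_iff' hwm] at hfg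
    refine integral_congr_ae ?_
    filter_upwards [hfg] with y hy
    by_cases hw0 : w y = 0
    · simp [hw0]
    · rw [hy (by simpa using hw0)]

theorem integral_withDensityᵥ_of_bound {X E F G : Type*} [MeasurableSpace X]
    [NormedAddCommGroup E] [NormedSpace ℝ E] [NormedAddCommGroup F] [NormedSpace ℝ F]
    [CompleteSpace F] [NormedAddCommGroup G] [NormedSpace ℝ G] [CompleteSpace G]
    (B : E →L[ℝ] F →L[ℝ] G) {l : Measure X} {w : X → F} (hw : Integrable w l) {g : X → E}
    (hg : AEStronglyMeasurable g l) {c : ℝ} (hc : ∀ᵐ y ∂l, ‖g y‖ ≤ c) :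
    (l.withDensityᵥ w).integral g B = ∫ y, B (g y) (w y) ∂l := by
  have : IsFiniteMeasure (l.withDensity fun y => ‖w y‖ₑ) := isFiniteMeasure_withDensity hw.2.ne
  have hac := withDensity_absolutelyContinuous l fun y => ‖w y‖ₑ
  exact integral_withDensityᵥ B hw (Integrable.of_bound (hg.mono_ac hac) c (hac hc))

/-! ### Measurability by means of separating sequences -/

/-- A countable generating family generates a countable algebra of sets, which is a π-system, so the
π-λ theorem applies. -/
theorem SignedMeasure.exists_separating_seq (X : Type*) [MeasurableSpace X]
    [MeasurableSpace.CountablyGenerated X] : ∃ A : ℕ → Set X, (∀ n, MeasurableSet (A n)) ∧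
      ∀ s s' : SignedMeasure X, (∀ n, s (A n) = s' (A n)) → s = s' := by
  obtain ⟨b, hb, hgen⟩ := MeasurableSpace.CountablyGenerated.isCountablyGenerated (α := X)
  have halg : IsSetAlgebra (generateSetAlgebra b) := isSetAlgebra_generateSetAlgebra
  obtain ⟨A, hA⟩ := (countable_generateSetAlgebra hb).exists_eq_range ⟨∅, halg.empty_mem⟩
  have hgen' : ‹MeasurableSpace X› = MeasurableSpace.generateFrom (generateSetAlgebra b) := by
    rw [generateFrom_generateSetAlgebra_eq, hgen]
  have hmeas : ∀ s ∈ generateSetAlgebra b, MeasurableSet s := fun s hs => by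
    rw [hgen']
    exact MeasurableSpace.measurableSet_generateFrom hs
  refine ⟨A, fun n => hmeas _ (hA ▸ mem_range_self n), fun s s' h => ?_⟩
  have h' : ∀ t ∈ generateSetAlgebra b, s t = s' t := by
    rw [hA]
    rintro _ ⟨n, rfl⟩
    exact h n
  -- The whole space belongs to the algebra; equality of the total masses is what the complement
  -- step needs.
  have huniv := h' univ halg.univ_mem
  ext t ht
  induction t, ht using MeasurableSpace.induction_on_inter hgen'
    (fun s hs t ht _ => halg.inter_mem hs ht) with
  | empty => simp
  | basic t ht => exact h' t ht
  | compl t ht ih =>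
    have h1 := VectorMeasure.of_add_of_sdiff (v := s) ht MeasurableSet.univ (subset_univ t)
    have h2 := VectorMeasure.of_add_of_sdiff (v := s') ht MeasurableSet.univ (subset_univ t)
    rw [← compl_eq_univ_sdiff] at h1 h2
    linarith
  | iUnion f hd hf ih =>
    rw [VectorMeasure.of_disjoint_iUnion hf hd, VectorMeasure.of_disjoint_iUnion hf hd]
    exact tsum_congr ih

/-- The Lusin–Souslin theorem: a continuous injection of a Polish space sends Borel sets to Borel
sets. -/
theorem measurableEmbedding_pi_of_separating {E ι : Type*} [TopologicalSpace E] [PolishSpace E]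
    [MeasurableSpace E] [BorelSpace E] [Countable ι] {f : ι → E → ℝ} (hf : ∀ i, Continuous (f i))
    (hsep : ∀ z w, (∀ i, f i z = f i w) → z = w) : MeasurableEmbedding fun z i => f i z :=
  (continuous_pi hf).measurableEmbedding fun z w h => hsep z w (congrFun h)

section Lp

variable {X : Type*} [MeasurableSpace X] {l : Measure X} [IsFiniteMeasure l]

lemma integrable_Lp_two (w : Lp ℝ 2 l) : Integrable w l :=
  (Lp.memLp w).integrable (by norm_num)

lemma continuous_setIntegral_Lp_two {A : Set X} (hA : MeasurableSet A) :
    Continuous fun w : Lp ℝ 2 l => ∫ y in A, w y ∂l := by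
  simp_rw [← L2.inner_indicatorConstLp_one (𝕜 := ℝ) hA (measure_ne_top l A)]
  fun_prop

lemma continuous_withDensityᵥ_Lp_two (A : Set X) :
    Continuous fun w : Lp ℝ 2 l => l.withDensityᵥ w A := by
  by_cases hA : MeasurableSet A
  · simp_rw [withDensityᵥ_apply (integrable_Lp_two _) hA]
    exact continuous_setIntegral_Lp_two hA
  · simp_rw [VectorMeasure.not_measurable _ hA]
    exact continuous_const

lemma Lp_two_ext_withDensityᵥ {w w' : Lp ℝ 2 l} (h : l.withDensityᵥ w = l.withDensityᵥ w') :
    w = w' :=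
  Lp.ext ((integrable_Lp_two w).ae_eq_of_withDensityᵥ_eq (integrable_Lp_two w') h)

/-- Through the embedding by evaluations on a separating sequence, measurability of an `L²`-valued
map reduces to that of the parameter integrals `∫ y in A n, g t y`. -/
theorem stronglyMeasurable_toLp {T : Type*} [MeasurableSpace T]
    [MeasurableSpace.CountablyGenerated X] {g : T → X → ℝ}
    (hg : StronglyMeasurable (Function.uncurry g)) (h : ∀ t, MemLp (g t) 2 l) :
    StronglyMeasurable fun t => (h t).toLp (g t) := by
  have : Fact ((2 : ℝ≥0∞) ≠ ⊤) := ⟨by norm_num⟩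
  borelize ↥(Lp ℝ 2 l)
  obtain ⟨A, hA, hsep⟩ := SignedMeasure.exists_separating_seq X
  have hemb := measurableEmbedding_pi_of_separating
    (f := fun (n : ℕ) (w : Lp ℝ 2 l) => l.withDensityᵥ w (A n))
    (fun n => continuous_withDensityᵥ_Lp_two _)
    (fun z w hzw => Lp_two_ext_withDensityᵥ (hsep _ _ hzw))
  refine Measurable.stronglyMeasurable (hemb.measurable_comp_iff.1 (measurable_pi_lambda _ ?_))
  intro n
  have : (fun t => l.withDensityᵥ ((h t).toLp (g t)) (A n))
      = fun t => ∫ y in A n, g t y ∂l := by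
    ext t
    rw [withDensityᵥ_apply (integrable_Lp_two _) (hA n)]
    exact integral_congr_ae (ae_restrict_of_ae (h t).coeFn_toLp)
  simp only [Function.comp_def]
  rw [this]
  exact (hg.integral_prod_right' (ν := l.restrict (A n))).measurable

end Lp

/-! ### Families of densities -/

section DensitySpace

variable {X K : Type*} [MeasurableSpace X] [Fintype K]

/-- Families `(w_k)` of densities `w_k ∈ L²(l_k)`. -/
abbrev DensitySpace (l : K → Measure X) : Type _ := PiLp 2 fun k => Lp ℝ 2 (l k)

variable {l : K → Measure X}

/-- A component of a family of densities. -/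
abbrev DensitySpace.comp (l : K → Measure X) (k : K) : DensitySpace l →L[ℝ] Lp ℝ 2 (l k) :=
  PiLp.proj 2 _ k

lemma DensitySpace.enorm_sq (z : DensitySpace l) : ‖z‖ₑ ^ 2 = ∑ k, ‖z k‖ₑ ^ 2 := by
  simp only [enorm_eq_nnnorm]
  rw [PiLp.nnnorm_eq_of_L2]
  norm_cast
  exact NNReal.sq_sqrt _

lemma DensitySpace.enorm_apply_sq_le (z : DensitySpace l) (k : K) : ‖z k‖ₑ ^ 2 ≤ ‖z‖ₑ ^ 2 := by
  rw [DensitySpace.enorm_sq]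
  exact Finset.single_le_sum (f := fun k => ‖z k‖ₑ ^ 2) (fun _ _ => zero_le) (Finset.mem_univ k)

variable [∀ k, IsFiniteMeasure (l k)]

instance [MeasurableSpace.CountablyGenerated X] : PolishSpace (DensitySpace l) := by
  have : Fact ((2 : ℝ≥0∞) ≠ ⊤) := ⟨by norm_num⟩
  have : ∀ k, SecondCountableTopology (Lp ℝ 2 (l k)) := fun k => inferInstance
  infer_instance

theorem DensitySpace.exists_measurableEmbedding [MeasurableSpace.CountablyGenerated X]
    [MeasurableSpace (DensitySpace l)] [BorelSpace (DensitySpace l)] :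
    ∃ A : ℕ → Set X, (∀ n, MeasurableSet (A n)) ∧
      (∀ s s' : SignedMeasure X, (∀ n, s (A n) = s' (A n)) → s = s') ∧
      MeasurableEmbedding fun (z : DensitySpace l) (i : K × ℕ) =>
        (l i.1).withDensityᵥ (z i.1) (A i.2) := by
  obtain ⟨A, hA, hsep⟩ := SignedMeasure.exists_separating_seq X
  refine ⟨A, hA, hsep, measurableEmbedding_pi_of_separating
    (f := fun (i : K × ℕ) (z : DensitySpace l) => (l i.1).withDensityᵥ (z i.1) (A i.2))
    (fun i => (continuous_withDensityᵥ_Lp_two _).comp (DensitySpace.comp l i.1).continuous) ?_⟩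
  intro z w h
  ext k : 1
  exact Lp_two_ext_withDensityᵥ (hsep _ _ fun n => h (k, n))

/-- If the densities of a measurable family of signed measures lie in `L²` for almost all times,
they form a measurable family. -/
theorem DensitySpace.exists_measurable_density [MeasurableSpace.CountablyGenerated X]
    {T : Type*} [MeasurableSpace T] {D : T → K → SignedMeasure X}
    (hD : ∀ k A, MeasurableSet A → Measurable fun t => D t k A) {Φ : DensitySpace l → ℝ≥0∞}
    (hΦ : LowerSemicontinuous Φ) :
    ∃ (Z : T → DensitySpace l) (a : T → ℝ≥0∞), StronglyMeasurable Z ∧ Measurable a ∧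
      (∀ t (z : DensitySpace l), (∀ k, D t k = (l k).withDensityᵥ (z k)) → Z t = z ∧ a t = Φ z) ∧
      ∀ t, (¬ ∃ z : DensitySpace l, ∀ k, D t k = (l k).withDensityᵥ (z k)) → a t = ⊤ := by
  borelize (DensitySpace l)
  obtain ⟨A, hA, hsep, hemb⟩ := DensitySpace.exists_measurableEmbedding (l := l)
  set I := fun (z : DensitySpace l) (i : K × ℕ) => (l i.1).withDensityᵥ (z i.1) (A i.2)
  have hDA : Measurable fun t => fun i : K × ℕ => D t i.1 (A i.2) :=
    measurable_pi_lambda _ fun i => hD _ _ (hA _)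
  -- Extending `id` along the embedding `I` inverts it on its range. Off the range, at times without
  -- square integrable densities, the defaults are `0` for the density and `⊤` for the action.
  refine ⟨fun t => Function.extend I id (fun _ => 0) fun i => D t i.1 (A i.2),
    fun t => Function.extend I Φ (fun _ => ⊤) fun i => D t i.1 (A i.2),
    ((hemb.measurable_extend measurable_id measurable_const).comp hDA).stronglyMeasurable,
    (hemb.measurable_extend hΦ.measurable measurable_const).comp hDA, ?_, ?_⟩
  · intro t z hz
    have : (fun i : K × ℕ => D t i.1 (A i.2)) = I z := by
      ext i
      rw [hz]
    simp only [this, hemb.injective.extend_apply]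
    exact ⟨rfl, trivial⟩
  · intro t ht
    refine Function.extend_apply' _ _ _ ?_
    rintro ⟨z, hz⟩
    exact ht ⟨z, fun k => hsep _ _ fun n => (congrFun hz (k, n)).symm⟩

/-- Integration of a bounded function against the components of a family of densities. -/
theorem DensitySpace.exists_pairing [MeasurableSpace.CountablyGenerated X]
    {T : Type*} [MeasurableSpace T] {ν : Measure T} [IsFiniteMeasure ν] (k : K) {g : T → X → ℝ}
    (hg : StronglyMeasurable (Function.uncurry g)) {c : ℝ} (hc : ∀ t, ∀ᵐ y ∂l k, ‖g t y‖ ≤ c) :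
    ∃ L : Lp (DensitySpace l) 2 ν →L[ℝ] ℝ, ∀ z : Lp (DensitySpace l) 2 ν,
      Integrable (fun t => ∫ y, g t y * z t k y ∂l k) ν ∧
      L z = ∫ t, ∫ y, g t y * z t k y ∂l k ∂ν := by
  have hmem : ∀ t, MemLp (g t) 2 (l k) := fun t =>
    MemLp.of_bound (hg.comp_measurable measurable_prodMk_left).aestronglyMeasurable c (hc t)
  have hsm := stronglyMeasurable_toLp hg hmem
  -- The test function becomes an element of `L²(ν; L²(l k))`, and the pairing an inner product with
  -- the component `k` of `z`.
  have hγ : MemLp (fun t => (hmem t).toLp (g t)) 2 ν := by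
    refine MemLp.of_bound hsm.aestronglyMeasurable
      (l k univ ^ (2 : ℝ≥0∞).toReal⁻¹ * ENNReal.ofReal c).toReal (Eventually.of_forall fun t => ?_)
    rw [Lp.norm_toLp]
    exact ENNReal.toReal_mono (by finiteness) (eLpNorm_le_of_ae_bound (p := 2) (hc t))
  have hcomp : ∀ z : Lp (DensitySpace l) 2 ν, ∀ᵐ t ∂ν,
      ⟪hγ.toLp _ t, (DensitySpace.comp l k).compLp z t⟫ = ∫ y, g t y * z t k y ∂l k := by
    intro z
    filter_upwards [hγ.coeFn_toLp, (DensitySpace.comp l k).coeFn_compLp z] with t h1 h2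
    rw [h1, h2, L2.inner_def]
    refine integral_congr_ae ?_
    filter_upwards [(hmem t).coeFn_toLp] with y hy
    rw [hy]
    simp [mul_comm]
  refine ⟨(innerSL ℝ (hγ.toLp _)).comp ((DensitySpace.comp l k).compLpL 2 ν), fun z => ⟨?_, ?_⟩⟩
  · exact (L2.integrable_inner (𝕜 := ℝ) _ _).congr (hcomp z)
  · rw [← integral_congr_ae (hcomp z)]
    rfl

end DensitySpace

/-! ### Operations on convex functionals -/

namespace ENNRealConvex

variable {H H' : Type*} [AddCommGroup H] [Module ℝ H] [AddCommGroup H'] [Module ℝ H']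
  {F F' : H → ℝ≥0∞}

lemma add (hF : ENNRealConvex F) (hF' : ENNRealConvex F') :
    ENNRealConvex fun x => F x + F' x := by
  intro x y s t hst
  refine (add_le_add (hF x y s t hst) (hF' x y s t hst)).trans (le_of_eq ?_)
  ring

lemma sum {ι : Type*} (I : Finset ι) {f : ι → H → ℝ≥0∞} (hf : ∀ i, ENNRealConvex (f i)) :
    ENNRealConvex fun x => ∑ i ∈ I, f i x := by
  intro x y s t hst
  refine (Finset.sum_le_sum fun i _ => hf i x y s t hst).trans (le_of_eq ?_)
  rw [Finset.sum_add_distrib, Finset.mul_sum, Finset.mul_sum]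

lemma const_mul (hF : ENNRealConvex F) (c : ℝ≥0∞) : ENNRealConvex fun x => c * F x := by
  intro x y s t hst
  refine (mul_le_mul_right (hF x y s t hst) c).trans (le_of_eq ?_)
  ring

lemma comp_linear (hF : ENNRealConvex F) (L : H' →ₗ[ℝ] H) :
    ENNRealConvex fun x => F (L x) := by
  intro x y s t hst
  simpa using hF (L x) (L y) s t hst

end ENNRealConvex

lemma LowerSemicontinuous.ennreal_const_mul {H : Type*} [TopologicalSpace H] {F : H → ℝ≥0∞}
    (hF : LowerSemicontinuous F) {c : ℝ≥0∞} (hc : c ≠ ⊤) :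
    LowerSemicontinuous fun x => c * F x :=
  (ENNReal.continuous_const_mul hc).comp_lowerSemicontinuous hF fun _ _ h => mul_le_mul_right h c

/-! ### The integral of the integrand as a functional of the densities -/

section PsiTerm

variable {X : Type*} [MeasurableSpace X] {l : Measure X} {m : ℝ≥0 → EReal}
  {E F ι : Type*} [NormedAddCommGroup E] [NormedSpace ℝ E] [NormedAddCommGroup F] [NormedSpace ℝ F]
  [Fintype ι] (hm : IsAdmissibleMobility m)

/-- The two arguments of the integrand are joined into one `L²` function depending linearly and
continuously on `z`, so the general results on integral functionals can be pulled back. -/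
lemma exists_joint_density (P : E →L[ℝ] Lp ℝ 2 l) (Q : ι → E →L[ℝ] Lp ℝ 2 l)
    (N : (ι → ℝ) →L[ℝ] F) : ∃ M : E →L[ℝ] Lp (ℝ × F) 2 l,
      ∀ z, M z =ᵐ[l] fun y => (P z y, N fun i => Q i z y) := by
  classical
  let A : ι → ℝ →L[ℝ] ℝ × F := fun i =>
    (ContinuousLinearMap.inr ℝ ℝ F).comp (N.comp (ContinuousLinearMap.single ℝ (fun _ => ℝ) i))
  refine ⟨((ContinuousLinearMap.inl ℝ ℝ F).compLpL 2 l).comp P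
    + ∑ i, ((A i).compLpL 2 l).comp (Q i), fun z => ?_⟩
  have hsum : ∀ᵐ y ∂l, (∑ i, (A i).compLp (Q i z)) y = ∑ i, (A i).compLp (Q i z) y := by
    filter_upwards [Lp.coeFn_finsetSum Finset.univ fun i => (A i).compLp (Q i z)] with y hy
    rw [hy]
    simp
  filter_upwards [Lp.coeFn_add ((ContinuousLinearMap.inl ℝ ℝ F).compLp (P z))
    (∑ i, (A i).compLp (Q i z)), hsum, (ContinuousLinearMap.inl ℝ ℝ F).coeFn_compLp (P z),
    eventually_all.2 fun i => (A i).coeFn_compLp (Q i z)] with y h1 h2 h3 h4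
  have h5 : N (fun i => Q i z y) = ∑ i, N (Pi.single i (Q i z y)) := by
    rw [← map_sum]
    congr 1
    exact (Finset.univ_sum_single _).symm
  have h6 : (((((ContinuousLinearMap.inl ℝ ℝ F).compLpL 2 l).comp P
    + ∑ i, ((A i).compLpL 2 l).comp (Q i)) z : Lp (ℝ × F) 2 l)) =
    (ContinuousLinearMap.inl ℝ ℝ F).compLp (P z) + ∑ i, (A i).compLp (Q i z) := by
    simp
    rfl
  rw [h6, h1, Pi.add_apply, h2, h3, h5]
  simp_rw [h4]
  ext
  · simp [A, Prod.fst_sum]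
  · simp [A, Prod.snd_sum]

include hm

lemma lowerSemicontinuous_lintegral_Psi (P : E →L[ℝ] Lp ℝ 2 l) (Q : ι → E →L[ℝ] Lp ℝ 2 l)
    (N : (ι → ℝ) →L[ℝ] F) :
    LowerSemicontinuous fun z => ∫⁻ y, Psi m (P z y) (N fun i => Q i z y) ∂l := by
  obtain ⟨M, hM⟩ := exists_joint_density P Q N
  convert (lowerSemicontinuous_lintegral_Lp (ν := l) (p := 2)
    (hm.lowerSemicontinuous_Psi (F := F))).comp M.continuous using 1
  ext z
  refine lintegral_congr_ae ?_
  filter_upwards [hM z] with y hy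
  rw [hy]

lemma convex_lintegral_Psi (P : E →L[ℝ] Lp ℝ 2 l) (Q : ι → E →L[ℝ] Lp ℝ 2 l)
    (N : (ι → ℝ) →L[ℝ] F) :
    ENNRealConvex fun z => ∫⁻ y, Psi m (P z y) (N fun i => Q i z y) ∂l := by
  obtain ⟨M, hM⟩ := exists_joint_density P Q N
  convert (ENNRealConvex.lintegral_Lp (ν := l) (p := 2)
    (hm.lowerSemicontinuous_Psi (F := F)) hm.Psi_convex).comp_linear M.toLinearMap using 1
  ext z
  refine lintegral_congr_ae ?_
  filter_upwards [hM z] with y hy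
  simp [hy]

omit [NormedSpace ℝ F] in
lemma aemeasurable_Psi {u : X → ℝ} {v : X → F} (hu : AEStronglyMeasurable u l)
    (hv : AEStronglyMeasurable v l) : AEMeasurable (fun y => Psi m (u y) (v y)) l :=
  hm.lowerSemicontinuous_Psi.aemeasurable_comp (hu.prodMk hv)

omit [NormedSpace ℝ F] in
variable (l F) in
-- Here `c` stands for the cost parameter of one term and `a` for the whole action. The pointwise
-- growth bound is integrated; measurability of `u` and `v` is not needed, since only constants are
-- added or multiplied.
lemma lintegral_enorm_sq_le_lintegral_Psi [IsFiniteMeasure l] {c : ℝ≥0} (hc : c ≠ 0) :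
    ∃ A B : ℝ≥0, ∀ (u : X → ℝ) (v : X → F) (a : ℝ≥0∞), c * ∫⁻ y, Psi m (u y) (v y) ∂l ≤ a →
      ∫⁻ y, (‖u y‖ₑ ^ 2 + ‖v y‖ₑ ^ 2) ∂l ≤ A * a + B := by
  obtain ⟨A, B, h⟩ := hm.exists_growth (F := F)
  refine ⟨(A + 1) * c⁻¹, B * (l univ).toNNReal, fun u v a ha => ?_⟩
  have hle : ∫⁻ y, Psi m (u y) (v y) ∂l ≤ (c⁻¹ : ℝ≥0) * a := by
    calc ∫⁻ y, Psi m (u y) (v y) ∂l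
        = (c⁻¹ : ℝ≥0) * (c * ∫⁻ y, Psi m (u y) (v y) ∂l) := by
          rw [← mul_assoc, ← ENNReal.coe_mul, inv_mul_cancel₀ hc]
          simp
      _ ≤ (c⁻¹ : ℝ≥0) * a := by gcongr
  calc ∫⁻ y, (‖u y‖ₑ ^ 2 + ‖v y‖ₑ ^ 2) ∂l
      ≤ ∫⁻ y, ((A + 1) * Psi m (u y) (v y) + B) ∂l := lintegral_mono fun y => h _ _
    _ = (A + 1) * ∫⁻ y, Psi m (u y) (v y) ∂l + B * l univ := by
        rw [lintegral_add_right _ measurable_const, lintegral_const_mul' _ _ (by finiteness),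
          lintegral_const]
    _ ≤ (A + 1) * ((c⁻¹ : ℝ≥0) * a) + B * l univ := by gcongr
    _ = (((A + 1) * c⁻¹ : ℝ≥0) : ℝ≥0∞) * a + ((B * (l univ).toNNReal : ℝ≥0) : ℝ≥0∞) := by
        push_cast
        rw [ENNReal.coe_toNNReal (measure_ne_top l univ), mul_assoc]

end PsiTerm

/-! ### The components of a tuple -/

/-- The scalar components of a tuple; `trace p` stands for the part of `ρ` at an outer vertex. -/
inductive Component {V : Type*} (G : MetricGraph V) (d : ℕ)
  | mu
  | J (i : Fin d)
  | rho (e : G.Edge)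
  | flux (e : G.Edge)
  | f (e : G.Edge)
  | trace (p : G.OuterEnd)
  | exchange (p : G.OuterEnd)

section Components

variable {V : Type*} {d : ℕ} {G : MetricGraph V}

instance [Finite V] : Fintype (Component G d) := by
  have : Finite (Component G d) := by
    let F : (Unit ⊕ Fin d) ⊕ (G.Edge ⊕ G.Edge ⊕ G.Edge) ⊕ G.OuterEnd ⊕ G.OuterEnd →
      Component G d := fun s => match s with
      | .inl (.inl _) => .mu
      | .inl (.inr i) => .J i
      | .inr (.inl (.inl e)) => .rho e
      | .inr (.inl (.inr (.inl e))) => .flux e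
      | .inr (.inl (.inr (.inr e))) => .f e
      | .inr (.inr (.inl p)) => .trace p
      | .inr (.inr (.inr p)) => .exchange p
    refine Finite.of_surjective F fun k => ?_
    cases k with
    | mu => exact ⟨.inl (.inl ()), rfl⟩
    | J i => exact ⟨.inl (.inr i), rfl⟩
    | rho e => exact ⟨.inr (.inl (.inl e)), rfl⟩
    | flux e => exact ⟨.inr (.inl (.inr (.inl e))), rfl⟩
    | f e => exact ⟨.inr (.inl (.inr (.inr e))), rfl⟩
    | trace p => exact ⟨.inr (.inr (.inl p)), rfl⟩
    | exchange p => exact ⟨.inr (.inr (.inr p)), rfl⟩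
  exact Fintype.ofFinite _

/-- The reference measure of a component. -/
def CostData.ref (C : CostData G d) : Component G d → Measure (Pt d)
  | .mu => C.lamBulk
  | .J _ => C.lamBulk
  | .rho e => C.lamEdge e
  | .flux e => C.lamEdge e
  | .f e => C.lamEdge e
  | .trace p => C.lamVertex p.vertex
  | .exchange p => C.lamVertex p.vertex

/-- A coordinate of a vector-valued measure. -/
def coordMeasure (J : VectorMeasure (Pt d) (Pt d)) (i : Fin d) : SignedMeasure (Pt d) :=
  J.mapRange (EuclideanSpace.proj i : Pt d →L[ℝ] ℝ).toLinearMap.toAddMonoidHom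
    (EuclideanSpace.proj i : Pt d →L[ℝ] ℝ).continuous

@[simp]
lemma coordMeasure_apply (J : VectorMeasure (Pt d) (Pt d)) (i : Fin d) (A : Set (Pt d)) :
    coordMeasure J i A = J A i := rfl

/-- The components of a tuple at a given time, as signed measures. -/
def Tuple.component (x : V → Pt d) (T : Tuple G d) (t : unitInterval) :
    Component G d → SignedMeasure (Pt d)
  | .mu => T.mu t
  | .J i => coordMeasure (T.J t) i
  | .rho e => T.rho t e
  | .flux e => T.flux t e
  | .f e => T.f t e
  | .trace p => (T.rho t p.edge).restrict {x p.vertex}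
  | .exchange p => T.exchange t p

variable [Finite V]

/-- The action of a family of densities. -/
def densityAction (C : CostData G d) (W : Component G d → Pt d → ℝ) : ℝ≥0∞ :=
  (∫⁻ y, Psi C.mobBulk (W .mu y) (WithLp.toLp 2 fun i => W (.J i) y : Pt d) ∂C.lamBulk)
  + (∑ e : G.Edge, ∫⁻ y,
      (ENNReal.ofReal C.α₁ * Psi C.mobGraph (W (.rho e) y) (W (.flux e) y)
        + ENNReal.ofReal C.α₂ * Psi C.mobGraph (W (.rho e) y) (W (.f e) y)) ∂(C.lamEdge e))
  + ENNReal.ofReal C.α₃ * ∑ p : G.OuterEnd, ∫⁻ y,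
      Psi C.mobGraph (W (.trace p) y) (W (.exchange p) y) ∂(C.lamVertex p.vertex)

lemma action_eq_densityAction (C : CostData G d) (x : V → Pt d) (T : Tuple G d)
    (t : unitInterval) : action C x T t =
      densityAction C fun k => (T.component x t k).rnDeriv (C.ref k) := rfl

lemma densityAction_congr (C : CostData G d) {W W' : Component G d → Pt d → ℝ}
    (h : ∀ k, W k =ᵐ[C.ref k] W' k) : densityAction C W = densityAction C W' := by
  unfold densityAction
  congr 2
  · refine lintegral_congr_ae ?_
    filter_upwards [h .mu, eventually_all.2 fun i => h (.J i)] with y h1 h2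
    simp_rw [h1, h2]
  · refine Finset.sum_congr rfl fun e _ => lintegral_congr_ae ?_
    filter_upwards [h (.rho e), h (.flux e), h (.f e)] with y h1 h2 h3
    rw [h1, h2, h3]
  · refine Finset.sum_congr rfl fun p _ => lintegral_congr_ae ?_
    filter_upwards [h (.trace p), h (.exchange p)] with y h1 h2
    rw [h1, h2]

/-- The action as a functional of families of square integrable densities. -/
def actionFunctional (C : CostData G d) (z : DensitySpace C.ref) : ℝ≥0∞ :=
  densityAction C fun k => z k

variable {C : CostData G d} {Ω : Set (Pt d)} {x : V → Pt d} (hC : C.IsAdmissible Ω x)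
include hC

omit [Finite V] in
lemma CostData.IsAdmissible.isFiniteMeasure_ref (k : Component G d) :
    IsFiniteMeasure (C.ref k) := by
  cases k with
  | mu => exact hC.lamBulk_finite
  | J i => exact hC.lamBulk_finite
  | rho e => exact hC.lamEdge_finite e
  | flux e => exact hC.lamEdge_finite e
  | f e => exact hC.lamEdge_finite e
  | trace p => exact hC.lamVertex_finite _
  | exchange p => exact hC.lamVertex_finite _

/-- Every argument is displayed as a continuous linear image of `z`, the shape required by the
lemmas on integrals of `Psi`. Scalar velocities are treated as families indexed by `Unit`. -/
lemma actionFunctional_eq (z : DensitySpace C.ref) : actionFunctional C z =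
    (∫⁻ y, Psi C.mobBulk (DensitySpace.comp C.ref .mu z y)
        ((EuclideanSpace.equiv (Fin d) ℝ).symm.toContinuousLinearMap
          fun i => DensitySpace.comp C.ref (.J i) z y) ∂C.lamBulk)
      + (∑ e : G.Edge,
        (ENNReal.ofReal C.α₁ * ∫⁻ y, Psi C.mobGraph (DensitySpace.comp C.ref (.rho e) z y)
          (ContinuousLinearMap.proj (R := ℝ) (φ := fun _ : Unit => ℝ) ()
            fun _ => DensitySpace.comp C.ref (.flux e) z y) ∂C.lamEdge e
        + ENNReal.ofReal C.α₂ * ∫⁻ y, Psi C.mobGraph (DensitySpace.comp C.ref (.rho e) z y)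
          (ContinuousLinearMap.proj (R := ℝ) (φ := fun _ : Unit => ℝ) ()
            fun _ => DensitySpace.comp C.ref (.f e) z y) ∂C.lamEdge e))
      + ENNReal.ofReal C.α₃ * ∑ p : G.OuterEnd, ∫⁻ y,
        Psi C.mobGraph (DensitySpace.comp C.ref (.trace p) z y)
          (ContinuousLinearMap.proj (R := ℝ) (φ := fun _ : Unit => ℝ) ()
            fun _ => DensitySpace.comp C.ref (.exchange p) z y) ∂C.lamVertex p.vertex := by
  unfold actionFunctional densityAction
  congr 2
  refine Finset.sum_congr rfl fun e _ => ?_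
  rw [lintegral_add_left', lintegral_const_mul' _ _ (by simp), lintegral_const_mul' _ _ (by simp)]
  · rfl
  · exact (aemeasurable_Psi hC.mobGraph (Lp.aestronglyMeasurable (z (.rho e)))
      (Lp.aestronglyMeasurable (z (.flux e)))).const_mul _

lemma lowerSemicontinuous_actionFunctional : LowerSemicontinuous (actionFunctional C) := by
  have h : actionFunctional C = _ := funext fun z => actionFunctional_eq hC z
  rw [h]
  refine LowerSemicontinuous.add (LowerSemicontinuous.add ?_ (lowerSemicontinuous_sum fun e _ =>
    LowerSemicontinuous.add ?_ ?_))
    (LowerSemicontinuous.ennreal_const_mul (lowerSemicontinuous_sum fun p _ => ?_) (by simp))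
  · exact lowerSemicontinuous_lintegral_Psi hC.mobBulk (DensitySpace.comp C.ref .mu)
      (fun i => DensitySpace.comp C.ref (.J i)) _
  · exact (lowerSemicontinuous_lintegral_Psi hC.mobGraph (DensitySpace.comp C.ref (.rho e))
      (fun _ : Unit => DensitySpace.comp C.ref (.flux e)) _).ennreal_const_mul (by simp)
  · exact (lowerSemicontinuous_lintegral_Psi hC.mobGraph (DensitySpace.comp C.ref (.rho e))
      (fun _ : Unit => DensitySpace.comp C.ref (.f e)) _).ennreal_const_mul (by simp)
  · exact lowerSemicontinuous_lintegral_Psi hC.mobGraph (DensitySpace.comp C.ref (.trace p))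
      (fun _ : Unit => DensitySpace.comp C.ref (.exchange p)) _

lemma convex_actionFunctional : ENNRealConvex (actionFunctional C) := by
  have h : actionFunctional C = _ := funext fun z => actionFunctional_eq hC z
  rw [h]
  refine ENNRealConvex.add (ENNRealConvex.add ?_ (ENNRealConvex.sum _ fun e =>
    ENNRealConvex.add ?_ ?_)) (ENNRealConvex.const_mul (ENNRealConvex.sum _ fun p => ?_) _)
  · exact convex_lintegral_Psi hC.mobBulk (DensitySpace.comp C.ref .mu)
      (fun i => DensitySpace.comp C.ref (.J i)) _
  · exact (convex_lintegral_Psi hC.mobGraph (DensitySpace.comp C.ref (.rho e))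
      (fun _ : Unit => DensitySpace.comp C.ref (.flux e)) _).const_mul _
  · exact (convex_lintegral_Psi hC.mobGraph (DensitySpace.comp C.ref (.rho e))
      (fun _ : Unit => DensitySpace.comp C.ref (.f e)) _).const_mul _
  · exact convex_lintegral_Psi hC.mobGraph (DensitySpace.comp C.ref (.trace p))
      (fun _ : Unit => DensitySpace.comp C.ref (.exchange p)) _

/-- Each component is an argument of some term of the action, and that term carries a positive
weight. The families `W` are arbitrary, so the bound also applies to Radon–Nikodym densities not yet
known to lie in `L²`. -/
lemma exists_component_growth (k : Component G d) : ∃ A B : ℝ≥0,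
    ∀ W : Component G d → Pt d → ℝ,
      ∫⁻ y, ‖W k y‖ₑ ^ 2 ∂(C.ref k) ≤ A * densityAction C W + B := by
  have := hC.isFiniteMeasure_ref
  have hbulk := hC.lamBulk_finite
  have hedge := hC.lamEdge_finite
  have hvert := hC.lamVertex_finite
  have h1 : C.α₁.toNNReal ≠ 0 := by simpa using hC.α₁_pos
  have h2 : C.α₂.toNNReal ≠ 0 := by simpa using hC.α₂_pos
  have h3 : C.α₃.toNNReal ≠ 0 := by simpa using hC.α₃_pos
  have hmu : ∀ W : Component G d → Pt d → ℝ, ((1 : ℝ≥0) : ℝ≥0∞) *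
      ∫⁻ y, Psi C.mobBulk (W .mu y) (WithLp.toLp 2 fun i => W (.J i) y : Pt d) ∂C.lamBulk
      ≤ densityAction C W := fun W => by
    rw [ENNReal.coe_one, one_mul]
    exact le_self_add.trans le_self_add
  have hflux : ∀ (e : G.Edge) (W : Component G d → Pt d → ℝ), (C.α₁.toNNReal : ℝ≥0∞) *
      ∫⁻ y, Psi C.mobGraph (W (.rho e) y) (W (.flux e) y) ∂C.lamEdge e
      ≤ densityAction C W := fun e W => by
    rw [← lintegral_const_mul' _ _ (by simp)]
    refine le_trans ?_ (le_add_self.trans le_self_add)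
    refine le_trans ?_ (Finset.single_le_sum (fun _ _ => zero_le) (Finset.mem_univ e))
    exact lintegral_mono fun y => le_self_add
  have hf : ∀ (e : G.Edge) (W : Component G d → Pt d → ℝ), (C.α₂.toNNReal : ℝ≥0∞) *
      ∫⁻ y, Psi C.mobGraph (W (.rho e) y) (W (.f e) y) ∂C.lamEdge e
      ≤ densityAction C W := fun e W => by
    rw [← lintegral_const_mul' _ _ (by simp)]
    refine le_trans ?_ (le_add_self.trans le_self_add)
    refine le_trans ?_ (Finset.single_le_sum (fun _ _ => zero_le) (Finset.mem_univ e))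
    exact lintegral_mono fun y => le_add_self
  have hexch : ∀ (p : G.OuterEnd) (W : Component G d → Pt d → ℝ), (C.α₃.toNNReal : ℝ≥0∞) *
      ∫⁻ y, Psi C.mobGraph (W (.trace p) y) (W (.exchange p) y) ∂C.lamVertex p.vertex
      ≤ densityAction C W := fun p W => by
    refine le_trans ?_ le_add_self
    refine mul_le_mul_right ?_ _
    exact Finset.single_le_sum (f := fun p : G.OuterEnd => ∫⁻ y,
      Psi C.mobGraph (W (.trace p) y) (W (.exchange p) y) ∂C.lamVertex p.vertex)
      (fun _ _ => zero_le) (Finset.mem_univ p)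
  cases k with
  | mu =>
    obtain ⟨A, B, h⟩ := lintegral_enorm_sq_le_lintegral_Psi C.lamBulk (Pt d) hC.mobBulk one_ne_zero
    exact ⟨A, B, fun W => (lintegral_mono fun y => le_self_add).trans (h _ _ _ (hmu W))⟩
  | J i =>
    obtain ⟨A, B, h⟩ := lintegral_enorm_sq_le_lintegral_Psi C.lamBulk (Pt d) hC.mobBulk one_ne_zero
    refine ⟨A, B, fun W => (lintegral_mono fun y => ?_).trans (h _ _ _ (hmu W))⟩
    refine le_trans ?_ le_add_self
    gcongr
    exact enorm_le_iff_norm_le.2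
      (PiLp.norm_apply_le (WithLp.toLp 2 fun i => W (.J i) y : Pt d) i)
  | rho e =>
    obtain ⟨A, B, h⟩ := lintegral_enorm_sq_le_lintegral_Psi (C.lamEdge e) ℝ hC.mobGraph h1
    exact ⟨A, B, fun W => (lintegral_mono fun y => le_self_add).trans (h _ _ _ (hflux e W))⟩
  | flux e =>
    obtain ⟨A, B, h⟩ := lintegral_enorm_sq_le_lintegral_Psi (C.lamEdge e) ℝ hC.mobGraph h1
    exact ⟨A, B, fun W => (lintegral_mono fun y => le_add_self).trans (h _ _ _ (hflux e W))⟩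
  | f e =>
    obtain ⟨A, B, h⟩ := lintegral_enorm_sq_le_lintegral_Psi (C.lamEdge e) ℝ hC.mobGraph h2
    exact ⟨A, B, fun W => (lintegral_mono fun y => le_add_self).trans (h _ _ _ (hf e W))⟩
  | trace p =>
    obtain ⟨A, B, h⟩ :=
      lintegral_enorm_sq_le_lintegral_Psi (C.lamVertex p.vertex) ℝ hC.mobGraph h3
    exact ⟨A, B, fun W => (lintegral_mono fun y => le_self_add).trans (h _ _ _ (hexch p W))⟩
  | exchange p =>
    obtain ⟨A, B, h⟩ :=
      lintegral_enorm_sq_le_lintegral_Psi (C.lamVertex p.vertex) ℝ hC.mobGraph h3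
    exact ⟨A, B, fun W => (lintegral_mono fun y => le_add_self).trans (h _ _ _ (hexch p W))⟩

lemma memLp_of_densityAction_lt_top {W : Component G d → Pt d → ℝ}
    (hW : ∀ k, AEStronglyMeasurable (W k) (C.ref k)) (h : densityAction C W < ⊤)
    (k : Component G d) : MemLp (W k) 2 (C.ref k) := by
  obtain ⟨A, B, hAB⟩ := exists_component_growth hC k
  refine ⟨hW k, ?_⟩
  rw [eLpNorm_lt_top_iff_lintegral_rpow_enorm_lt_top (by norm_num) (by norm_num)]
  have := (hAB W).trans_lt (ENNReal.add_lt_top.2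
    ⟨ENNReal.mul_lt_top ENNReal.coe_lt_top h, ENNReal.coe_lt_top⟩)
  simpa using this

lemma quadraticGrowth_actionFunctional : QuadraticGrowth (actionFunctional C) := by
  choose A B hAB using exists_component_growth hC
  refine ⟨∑ k, A k, ∑ k, B k, fun z => ?_⟩
  rw [DensitySpace.enorm_sq]
  push_cast
  rw [Finset.sum_mul, ← Finset.sum_add_distrib]
  refine Finset.sum_le_sum fun k _ => ?_
  rw [enorm_sq_Lp_two]
  exact hAB k fun k => z k

end Components

/-! ### Passing between tuples of measures and families of densities. -/

lemma rnDeriv_withDensityᵥ_ae_eq {X : Type*} [MeasurableSpace X] {l : Measure X} [SigmaFinite l]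
    {w : X → ℝ} (hw : Integrable w l) : SignedMeasure.rnDeriv (l.withDensityᵥ w) l =ᵐ[l] w := by
  refine (SignedMeasure.integrable_rnDeriv _ _).ae_eq_of_withDensityᵥ_eq hw ?_
  exact (SignedMeasure.absolutelyContinuous_iff_withDensityᵥ_rnDeriv_eq (l.withDensityᵥ w) l).1
    (l.withDensityᵥ_absolutelyContinuous w)

lemma isMeasureFamily_withDensityᵥ {d : ℕ} {F : Type*} [NormedAddCommGroup F] [NormedSpace ℝ F]
    [CompleteSpace F] [MeasurableSpace F] {U : Set (Pt d)} {l : Measure (Pt d)} (hl : l Uᶜ = 0)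
    {w : unitInterval → Pt d → F} (hw : ∀ t, Integrable (w t) l)
    (hmeas : ∀ A, MeasurableSet A → Measurable fun t => ∫ y in A, w t y ∂l)
    (hint : ∫⁻ t, ∫⁻ y, ‖w t y‖ₑ ∂l < ⊤) :
    IsMeasureFamily U fun t => l.withDensityᵥ (w t) where
  concentrated t A hA hAU := by
    rw [withDensityᵥ_apply (hw t) hA, Measure.restrict_eq_zero.2, integral_zero_measure]
    exact measure_mono_null (fun y hy hyU => disjoint_left.1 hAU hy hyU) hl
  measurable A hA := by
    simp_rw [withDensityᵥ_apply (hw _) hA]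
    exact hmeas A hA
  integrable := by
    refine lt_of_eq_of_lt (lintegral_congr fun t => ?_) hint
    rw [Measure.variation_withDensityᵥ (hw t), withDensity_apply _ MeasurableSet.univ,
      Measure.restrict_univ]

lemma lintegral_enorm_le_add_lintegral_enorm_sq {X F : Type*} [MeasurableSpace X]
    [NormedAddCommGroup F] (l : Measure X) (w : X → F) :
    ∫⁻ y, ‖w y‖ₑ ∂l ≤ l univ + ∫⁻ y, ‖w y‖ₑ ^ 2 ∂l := by
  calc ∫⁻ y, ‖w y‖ₑ ∂l ≤ ∫⁻ y, (1 + ‖w y‖ₑ ^ 2) ∂l := by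
        refine lintegral_mono fun y => ?_
        rcases le_total ‖w y‖ₑ 1 with h | h
        · exact h.trans le_self_add
        · exact (le_self_pow₀ h two_ne_zero).trans le_add_self
    _ = l univ + ∫⁻ y, ‖w y‖ₑ ^ 2 ∂l := by
        rw [lintegral_add_left measurable_const]
        simp

section Correspondence

variable {V : Type*} {d : ℕ} {G : MetricGraph V} {C : CostData G d} {Ω : Set (Pt d)} {x : V → Pt d}

lemma absContAt_iff {T : Tuple G d} {t : unitInterval} : AbsContAt C x T t ↔
    ∀ k, T.component x t k ≪ᵥ (C.ref k).toENNRealVectorMeasure := by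
  constructor
  · intro h k
    cases k with
    | mu => exact h.mu
    | J i => exact fun A hA => by simp [Tuple.component, h.J hA]
    | rho e => exact h.rho e
    | flux e => exact h.flux e
    | f e => exact h.f e
    | trace p => exact h.rho_vertex p
    | exchange p => exact h.exchange p
  · intro h
    exact ⟨h .mu, fun A hA => by ext i; exact h (.J i) hA, fun e => h (.rho e),
      fun e => h (.flux e), fun e => h (.f e), fun p => h (.trace p), fun p => h (.exchange p)⟩

lemma IsAdmissibleTuple.measurable_component {T : Tuple G d} (hT : IsAdmissibleTuple Ω x T)
    (k : Component G d) {A : Set (Pt d)} (hA : MeasurableSet A) :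
    Measurable fun t => T.component x t k A := by
  cases k with
  | mu => exact hT.mu.measurable A hA
  | J i => exact (EuclideanSpace.proj i : Pt d →L[ℝ] ℝ).measurable.comp (hT.J.measurable A hA)
  | rho e => exact (hT.rho e).measurable A hA
  | flux e => exact (hT.flux e).measurable A hA
  | f e => exact (hT.f e).measurable A hA
  | trace p =>
    simp only [Tuple.component,
      VectorMeasure.restrict_apply _ (measurableSet_singleton (x p.vertex)) hA]
    exact (hT.rho _).measurable _ (hA.inter (measurableSet_singleton _))
  | exchange p => exact (hT.exchange p).measurable A hA

variable [Finite V]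

/-- A tuple of finite action is given by square integrable densities. -/
theorem exists_density_of_totalAction_lt_top (hC : C.IsAdmissible Ω x) {T : Tuple G d}
    (hT : IsAdmissibleTuple Ω x T) (hfin : totalAction C x T < ⊤) :
    ∃ z : Lp (DensitySpace C.ref) 2 (volume : Measure unitInterval),
      (∀ᵐ t, ∀ k, T.component x t k = (C.ref k).withDensityᵥ (z t k)) ∧
      ∫⁻ t, actionFunctional C (z t) = totalAction C x T := by
  have := hC.isFiniteMeasure_ref
  have hac : ∀ᵐ t, AbsContAt C x T t := by
    by_contra h
    rw [totalAction, if_neg h] at hfin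
    exact lt_irrefl _ hfin
  rw [totalAction, if_pos hac] at hfin ⊢
  obtain ⟨Z, a, hZ, ha, h1, h2⟩ := DensitySpace.exists_measurable_density (l := C.ref)
    (fun k A hA => hT.measurable_component k hA) (lowerSemicontinuous_actionFunctional hC)
  have hdens : ∀ {t}, ∀ z : DensitySpace C.ref,
      (∀ k, T.component x t k = (C.ref k).withDensityᵥ (z k)) →
      action C x T t = actionFunctional C z := by
    intro t z hz
    rw [action_eq_densityAction]
    refine densityAction_congr C fun k => ?_
    rw [hz]
    exact rnDeriv_withDensityᵥ_ae_eq (integrable_Lp_two (z k))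
  have hex : ∀ {t}, AbsContAt C x T t → action C x T t < ⊤ → ∃ z : DensitySpace C.ref,
      ∀ k, T.component x t k = (C.ref k).withDensityᵥ (z k) := by
    intro t ht hta
    -- Finite action at time `t` makes the Radon–Nikodym derivatives square integrable.
    have hmem := memLp_of_densityAction_lt_top hC
      (fun k => (SignedMeasure.measurable_rnDeriv (T.component x t k) (C.ref k)).aestronglyMeasurable)
      hta
    refine ⟨WithLp.toLp 2 fun k => (hmem k).toLp _, fun k => ?_⟩
    rw [← ((T.component x t k).absolutelyContinuous_iff_withDensityᵥ_rnDeriv_eq _).1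
      (absContAt_iff.1 ht k)]
    exact WithDensityᵥEq.congr_ae (hmem k).coeFn_toLp.symm
  -- This supplies a measurable version of the action. Where no square integrable densities exist,
  -- absolute continuity forces infinite action, in agreement with the default `⊤` of `a`.
  have haction : ∀ᵐ t, action C x T t = a t := by
    filter_upwards [hac] with t ht
    by_cases h : ∃ z : DensitySpace C.ref, ∀ k, T.component x t k = (C.ref k).withDensityᵥ (z k)
    · obtain ⟨z, hz⟩ := h
      rw [hdens z hz, (h1 t z hz).2]
    · rw [h2 t h]
      by_contra h'
      exact h (hex ht (lt_top_iff_ne_top.2 h'))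
  rw [lintegral_congr_ae haction] at hfin ⊢
  have hZt : ∀ᵐ t, (∀ k, T.component x t k = (C.ref k).withDensityᵥ (Z t k)) ∧
      a t = actionFunctional C (Z t) := by
    filter_upwards [hac, haction, ae_lt_top ha hfin.ne] with t ht hat hatop
    obtain ⟨z, hz⟩ := hex ht (hat ▸ hatop)
    obtain ⟨hz1, hz2⟩ := h1 t z hz
    rw [hz1]
    exact ⟨hz, hz2⟩
  have hZmem : MemLp Z 2 (volume : Measure unitInterval) := by
    refine ⟨hZ.aestronglyMeasurable, ?_⟩
    rw [eLpNorm_lt_top_iff_lintegral_rpow_enorm_lt_top (by norm_num) (by norm_num)]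
    obtain ⟨A, B, hAB⟩ := quadraticGrowth_actionFunctional hC
    calc ∫⁻ t, ‖Z t‖ₑ ^ (2 : ℝ≥0∞).toReal ≤ ∫⁻ t, (A * a t + B) := by
          refine lintegral_mono_ae ?_
          filter_upwards [hZt] with t ht
          rw [ht.2]
          simpa using hAB (Z t)
      _ = A * (∫⁻ t, a t) + B := by
          rw [lintegral_add_right _ measurable_const, lintegral_const_mul _ ha]
          simp
      _ < ⊤ := by
          have := hfin.ne
          finiteness
  refine ⟨hZmem.toLp Z, ?_, ?_⟩
  · filter_upwards [hZt, hZmem.coeFn_toLp] with t ht hz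
    rw [hz]
    exact ht.1
  · refine lintegral_congr_ae ?_
    filter_upwards [hZt, hZmem.coeFn_toLp] with t ht hz
    rw [hz, ht.2]

omit [Finite V] in
/-- The tuple of measures with given densities. -/
def Tuple.ofDensity (C : CostData G d) (W : unitInterval → Component G d → Pt d → ℝ) :
    Tuple G d where
  mu t := C.lamBulk.withDensityᵥ (W t .mu)
  J t := C.lamBulk.withDensityᵥ fun y => (WithLp.toLp 2 fun i => W t (.J i) y : Pt d)
  rho t e := (C.lamEdge e).withDensityᵥ (W t (.rho e))
  flux t e := (C.lamEdge e).withDensityᵥ (W t (.flux e))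
  f t e := (C.lamEdge e).withDensityᵥ (W t (.f e))
  exchange t p := (C.lamVertex p.vertex).withDensityᵥ (W t (.exchange p))

lemma integrable_toLp {l : Measure (Pt d)} {W : Fin d → Pt d → ℝ} (hW : ∀ i, Integrable (W i) l) :
    Integrable (fun y => (WithLp.toLp 2 fun i => W i y : Pt d)) l :=
  (EuclideanSpace.equiv (Fin d) ℝ).symm.toContinuousLinearMap.integrable_comp
    (Integrable.of_eval hW)

lemma setIntegral_toLp_apply {l : Measure (Pt d)} {W : Fin d → Pt d → ℝ}
    (hW : ∀ i, Integrable (W i) l) (A : Set (Pt d)) (i : Fin d) :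
    (∫ y in A, (WithLp.toLp 2 fun i => W i y : Pt d) ∂l) i = ∫ y in A, W i y ∂l :=
  ((EuclideanSpace.proj i : Pt d →L[ℝ] ℝ).integral_comp_comm
    (integrable_toLp hW).integrableOn).symm

omit [Finite V] in
-- The trace components are excluded because `Tuple.ofDensity` ignores `W` there: the vertex part is
-- already determined by the density of `ρ`.
lemma Tuple.component_ofDensity {W : unitInterval → Component G d → Pt d → ℝ}
    (hW : ∀ t k, Integrable (W t k) (C.ref k)) (t : unitInterval) (k : Component G d)
    (hk : ∀ p, k ≠ .trace p) :
    (Tuple.ofDensity C W).component x t k = (C.ref k).withDensityᵥ (W t k) := by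
  cases k with
  | J i =>
    ext A hA
    have hJ := fun i => hW t (.J i)
    simp only [CostData.ref] at hJ
    rw [Tuple.component, coordMeasure_apply, Tuple.ofDensity,
      withDensityᵥ_apply (integrable_toLp hJ) hA, setIntegral_toLp_apply hJ,
      withDensityᵥ_apply (hW t _) hA]
    rfl
  | trace p => exact absurd rfl (hk p)
  | _ => rfl

omit [Finite V] in
-- Both measures are carried by the single point `x p.vertex`, so equality of their masses there
-- suffices.
lemma Tuple.component_ofDensity_trace (hC : C.IsAdmissible Ω x)
    {W : unitInterval → Component G d → Pt d → ℝ}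
    (hW : ∀ t k, Integrable (W t k) (C.ref k)) (t : unitInterval) (p : G.OuterEnd)
    (h : ∫ y in {x p.vertex}, W t (.rho p.edge) y ∂C.lamEdge p.edge
      = ∫ y, W t (.trace p) y ∂C.lamVertex p.vertex) :
    (Tuple.ofDensity C W).component x t (.trace p)
      = (C.ref (.trace p)).withDensityᵥ (W t (.trace p)) := by
  ext A hA
  have hx := measurableSet_singleton (x p.vertex)
  have hconc := hC.lamVertex_concentrated p.vertex
  rw [Tuple.component, VectorMeasure.restrict_apply _ hx hA, withDensityᵥ_apply (hW t _) hA]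
  change (C.lamEdge p.edge).withDensityᵥ (W t (.rho p.edge)) _ = _
  have hρ : Integrable (W t (.rho p.edge)) (C.lamEdge p.edge) := hW t (.rho p.edge)
  rw [withDensityᵥ_apply hρ (hA.inter hx)]
  simp only [CostData.ref]
  by_cases hmem : x p.vertex ∈ A
  · rw [inter_eq_right.2 (singleton_subset_iff.2 hmem), h]
    rw [← setIntegral_univ]
    refine (setIntegral_congr_set ?_)
    refine (ae_eq_univ.2 (measure_mono_null ?_ hconc)).symm
    exact compl_subset_compl.2 (singleton_subset_iff.2 hmem)
  · rw [inter_singleton_eq_empty.2 hmem, setIntegral_empty, Measure.restrict_eq_zero.2,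
      integral_zero_measure]
    exact measure_mono_null (subset_compl_singleton_iff.2 hmem) hconc

end Correspondence

/-! ### Admissibility, vertex compatibility and action of the tuple with given densities. -/

section OfDensity

variable {V : Type*} [Finite V] {d : ℕ} {G : MetricGraph V} {C : CostData G d} {Ω : Set (Pt d)}
  {x : V → Pt d} (hC : C.IsAdmissible Ω x)

lemma lintegral_lt_top_of_le_enorm_sq {T E : Type*} [MeasurableSpace T] {ν : Measure T}
    [IsFiniteMeasure ν] [NormedAddCommGroup E] (z : Lp E 2 ν) {g : T → ℝ≥0∞} {a b : ℝ≥0∞}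
    (ha : a ≠ ⊤) (hb : b ≠ ⊤) (hg : ∀ t, g t ≤ a + b * ‖z t‖ₑ ^ 2) : ∫⁻ t, g t ∂ν < ⊤ := by
  calc ∫⁻ t, g t ∂ν ≤ ∫⁻ t, (a + b * ‖z t‖ₑ ^ 2) ∂ν := lintegral_mono hg
    _ = a * ν univ + b * ‖z‖ₑ ^ 2 := by
        rw [lintegral_add_left measurable_const, enorm_sq_Lp_two, lintegral_const,
          lintegral_const_mul' _ _ hb]
    _ < ⊤ := by finiteness

include hC

/-- A tuple with square integrable densities is admissible. -/
lemma isAdmissibleTuple_ofDensity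
    (z : Lp (DensitySpace C.ref) 2 (volume : Measure unitInterval)) :
    IsAdmissibleTuple Ω x (Tuple.ofDensity C fun t k => z t k) := by
  have := hC.isFiniteMeasure_ref
  have hint : ∀ t k, Integrable (z t k) (C.ref k) := fun t k => integrable_Lp_two _
  have hmeas : ∀ k A, MeasurableSet A → Measurable fun t => ∫ y in A, z t k y ∂(C.ref k) := by
    intro k A hA
    -- The chosen representative of `z` is strongly measurable, so measurability in time follows by
    -- composing with a continuous functional.
    exact (((continuous_setIntegral_Lp_two hA).comp
      (DensitySpace.comp C.ref k).continuous).comp_stronglyMeasurable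
      (Lp.stronglyMeasurable z)).measurable
  have hle : ∀ t k, ∫⁻ y, ‖z t k y‖ₑ ^ 2 ∂(C.ref k) ≤ ‖z t‖ₑ ^ 2 := by
    intro t k
    rw [← enorm_sq_Lp_two]
    exact DensitySpace.enorm_apply_sq_le _ k
  have hscal : ∀ k (U : Set (Pt d)), C.ref k Uᶜ = 0 →
      IsMeasureFamily U fun t => (C.ref k).withDensityᵥ (z t k) := by
    intro k U hU
    refine isMeasureFamily_withDensityᵥ hU (fun t => hint t k) (hmeas k) ?_
    refine lintegral_lt_top_of_le_enorm_sq z (measure_ne_top (C.ref k) univ) ENNReal.one_ne_top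
      fun t => ?_
    rw [one_mul]
    refine (lintegral_enorm_le_add_lintegral_enorm_sq _ _).trans ?_
    gcongr
    exact hle t k
  refine ⟨hscal .mu Ω hC.lamBulk_concentrated, ?_,
    fun e => hscal (.rho e) _ (hC.lamEdge_concentrated e),
    fun e => hscal (.flux e) _ (hC.lamEdge_concentrated e),
    fun e => hscal (.f e) _ (hC.lamEdge_concentrated e),
    fun p => hscal (.exchange p) _ (hC.lamVertex_concentrated _)⟩
  have hJ : ∀ t i, Integrable (z t (.J i)) C.lamBulk := fun t i => hint t (.J i)
  have hbulk := hC.lamBulk_finite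
  refine isMeasureFamily_withDensityᵥ hC.lamBulk_concentrated (fun t => integrable_toLp (hJ t)) ?_ ?_
  · intro A hA
    have : (fun t => ∫ y in A, (WithLp.toLp 2 fun i => z t (.J i) y : Pt d) ∂C.lamBulk) =
        fun t => (WithLp.toLp 2 fun i => ∫ y in A, z t (.J i) y ∂C.lamBulk : Pt d) := by
      ext t i
      exact setIntegral_toLp_apply (hJ t) A i
    rw [this]
    exact (PiLp.continuous_toLp 2 _).measurable.comp
      (measurable_pi_lambda _ fun i => hmeas (.J i) A hA)
  · refine lintegral_lt_top_of_le_enorm_sq z (measure_ne_top C.lamBulk univ)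
      (ENNReal.natCast_ne_top d) fun t => ?_
    refine (lintegral_enorm_le_add_lintegral_enorm_sq _ _).trans ?_
    gcongr
    have hsq : ∀ v : Fin d → ℝ, ‖(WithLp.toLp 2 v : Pt d)‖ₑ ^ 2 = ∑ i, ‖v i‖ₑ ^ 2 := by
      intro v
      simp only [enorm_eq_nnnorm]
      rw [EuclideanSpace.nnnorm_eq]
      norm_cast
      exact NNReal.sq_sqrt _
    simp_rw [hsq]
    rw [lintegral_finsetSum' _ fun i _ => (hJ t i).aestronglyMeasurable.enorm.pow_const 2]
    refine (Finset.sum_le_sum fun i _ => hle t (.J i)).trans ?_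
    simp

omit [Finite V] in
/-- Compatibility of the density of `ρ` with the density of its part at an outer vertex. -/
lemma exists_traceMap [Fintype (Component G d)] (p : G.OuterEnd) : ∃ L : DensitySpace C.ref →L[ℝ] ℝ, ∀ z, L z =
    (∫ y in {x p.vertex}, z (.rho p.edge) y ∂C.lamEdge p.edge)
      - ∫ y, z (.trace p) y ∂C.lamVertex p.vertex := by
  have := hC.isFiniteMeasure_ref
  have hx := measurableSet_singleton (x p.vertex)
  refine ⟨(innerSL ℝ (indicatorConstLp 2 hx (measure_ne_top (C.ref (.rho p.edge)) _) (1 : ℝ))).comp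
      (DensitySpace.comp C.ref (.rho p.edge))
    - (innerSL ℝ (indicatorConstLp 2 MeasurableSet.univ
      (measure_ne_top (C.ref (.trace p)) _) (1 : ℝ))).comp (DensitySpace.comp C.ref (.trace p)),
    fun z => ?_⟩
  have h1 := L2.inner_indicatorConstLp_one (𝕜 := ℝ) hx
    (measure_ne_top (C.ref (.rho p.edge)) _) (z (.rho p.edge))
  have h2 := L2.inner_indicatorConstLp_one (𝕜 := ℝ) MeasurableSet.univ
    (measure_ne_top (C.ref (.trace p)) _) (z (.trace p))
  rw [setIntegral_univ] at h2
  exact congrArg₂ (· - ·) h1 h2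

/-- Compatibility at the outer vertices, for almost all times, is a continuous linear constraint. -/
lemma exists_traceConstraint :
    ∃ L : Lp (DensitySpace C.ref) 2 (volume : Measure unitInterval) →L[ℝ]
        (G.OuterEnd → Lp ℝ 2 (volume : Measure unitInterval)),
      ∀ z, L z = 0 ↔ ∀ᵐ t, ∀ p : G.OuterEnd,
        ∫ y in {x p.vertex}, z t (.rho p.edge) y ∂C.lamEdge p.edge
          = ∫ y, z t (.trace p) y ∂C.lamVertex p.vertex := by
  choose L hL using exists_traceMap hC
  refine ⟨ContinuousLinearMap.pi fun p => (L p).compLpL 2 volume, fun z => ?_⟩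
  rw [funext_iff, eventually_all]
  refine forall_congr' fun p => ?_
  change (L p).compLp z = 0 ↔ _
  rw [Lp.eq_zero_iff_ae_eq_zero]
  have h := (L p).coeFn_compLp z
  constructor
  · intro h0
    filter_upwards [h, h0] with t h1 h2
    rw [h1, hL, Pi.zero_apply] at h2
    linarith
  · intro h0
    filter_upwards [h, h0] with t h1 h2
    rw [h1, hL, h2, sub_self, Pi.zero_apply]

/-- The components of the tuple with densities `z`. -/
lemma component_ofDensity_ae (z : Lp (DensitySpace C.ref) 2 (volume : Measure unitInterval))
    (hz : ∀ᵐ t, ∀ p : G.OuterEnd,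
        ∫ y in {x p.vertex}, z t (.rho p.edge) y ∂C.lamEdge p.edge
          = ∫ y, z t (.trace p) y ∂C.lamVertex p.vertex) :
    ∀ᵐ t, ∀ k, (Tuple.ofDensity C fun t k => z t k).component x t k
      = (C.ref k).withDensityᵥ (z t k) := by
  have := hC.isFiniteMeasure_ref
  have hint : ∀ t k, Integrable (z t k) (C.ref k) := fun t k => integrable_Lp_two _
  filter_upwards [hz] with t ht k
  by_cases hk : ∃ p, k = .trace p
  · obtain ⟨p, rfl⟩ := hk
    exact Tuple.component_ofDensity_trace hC hint t p (ht p)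
  · exact Tuple.component_ofDensity hint t k fun p hp => hk ⟨p, hp⟩

lemma trace_of_component {T : Tuple G d}
    {z : Lp (DensitySpace C.ref) 2 (volume : Measure unitInterval)}
    (hz : ∀ᵐ t, ∀ k, T.component x t k = (C.ref k).withDensityᵥ (z t k)) :
    ∀ᵐ t, ∀ p : G.OuterEnd,
        ∫ y in {x p.vertex}, z t (.rho p.edge) y ∂C.lamEdge p.edge
          = ∫ y, z t (.trace p) y ∂C.lamVertex p.vertex := by
  have := hC.isFiniteMeasure_ref
  have hint : ∀ t k, Integrable (z t k) (C.ref k) := fun t k => integrable_Lp_two _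
  filter_upwards [hz] with t ht p
  have hx := measurableSet_singleton (x p.vertex)
  have h1 : T.component x t (.trace p) univ = T.component x t (.rho p.edge) {x p.vertex} := by
    change (T.rho t p.edge).restrict {x p.vertex} univ = T.rho t p.edge {x p.vertex}
    rw [VectorMeasure.restrict_apply _ hx MeasurableSet.univ, univ_inter]
  rw [ht, ht, withDensityᵥ_apply (hint _ _) MeasurableSet.univ, withDensityᵥ_apply (hint _ _) hx,
    setIntegral_univ] at h1
  exact h1.symm

lemma totalAction_eq_of_component {T : Tuple G d}
    {z : Lp (DensitySpace C.ref) 2 (volume : Measure unitInterval)}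
    (hz : ∀ᵐ t, ∀ k, T.component x t k = (C.ref k).withDensityᵥ (z t k)) :
    totalAction C x T = ∫⁻ t, actionFunctional C (z t) := by
  have := hC.isFiniteMeasure_ref
  have hac : ∀ᵐ t, AbsContAt C x T t := by
    filter_upwards [hz] with t ht
    refine absContAt_iff.2 fun k => ?_
    rw [ht]
    exact Measure.withDensityᵥ_absolutelyContinuous _ _
  rw [totalAction, if_pos hac]
  refine lintegral_congr_ae ?_
  filter_upwards [hz] with t ht
  rw [action_eq_densityAction]
  refine densityAction_congr C fun k => ?_
  rw [ht]
  exact rnDeriv_withDensityᵥ_ae_eq (integrable_Lp_two (z t k))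

end OfDensity

/-! ### Joint continuity of the derivatives of test functions. -/

section TestFunctions

variable {F : Type*} [NormedAddCommGroup F] [NormedSpace ℝ F] {φ : ℝ → F → ℝ}

lemma continuous_deriv_time (hφ : ContDiff ℝ 1 fun z : ℝ × F => φ z.1 z.2) :
    Continuous fun z : ℝ × F => deriv (fun r => φ r z.2) z.1 := by
  have h : ContDiff ℝ 0 fun z : ℝ × F => fderiv ℝ (fun r => φ r z.2) z.1 := by
    refine ContDiff.fderiv (f := fun (z : ℝ × F) r => φ r z.2) (m := 1) ?_ contDiff_fst (by simp)
    exact hφ.comp (contDiff_snd.prodMk (contDiff_snd.comp contDiff_fst))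
  exact h.continuous.clm_apply continuous_const

lemma continuous_fderiv_space (hφ : ContDiff ℝ 1 fun z : ℝ × F => φ z.1 z.2) :
    Continuous fun z : ℝ × F => fderiv ℝ (φ z.1) z.2 := by
  have h : ContDiff ℝ 0 fun z : ℝ × F => fderiv ℝ (φ z.1) z.2 := by
    refine ContDiff.fderiv (f := fun (z : ℝ × F) => φ z.1) (m := 1) ?_ contDiff_snd (by simp)
    exact hφ.comp ((contDiff_fst.comp contDiff_fst).prodMk contDiff_snd)
  exact h.continuous

lemma continuous_gradient_space {d : ℕ} {φ : ℝ → Pt d → ℝ}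
    (hφ : ContDiff ℝ 1 fun z : ℝ × Pt d => φ z.1 z.2) :
    Continuous fun z : ℝ × Pt d => ∇ (φ z.1) z.2 :=
  (InnerProductSpace.toDual ℝ (Pt d)).symm.continuous.comp (continuous_fderiv_space hφ)

end TestFunctions

/-! ### The weak equations as continuous linear constraints on the densities. -/

section Equations

variable {V : Type*} [Finite V] {d : ℕ} {G : MetricGraph V} {C : CostData G d} {Ω : Set (Pt d)}
  {x : V → Pt d}

variable (C) in
/-- The signed measures that make up a tuple have the densities `z` at almost all times. -/
def HasDensity (x : V → Pt d) (T : Tuple G d)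
    (z : Lp (DensitySpace C.ref) 2 (volume : Measure unitInterval)) : Prop :=
  ∀ᵐ t, ∀ k, T.component x t k = (C.ref k).withDensityᵥ (z t k)

lemma exists_bound_of_continuous {U : Set (Pt d)} (hU : IsCompact U) {F : Type*}
    [NormedAddCommGroup F] {g : ℝ × Pt d → F} (hg : Continuous g) {l : Measure (Pt d)}
    (hl : l Uᶜ = 0) : ∃ c, ∀ t : unitInterval, ∀ᵐ y ∂l, ‖g (t, y)‖ ≤ c := by
  obtain ⟨c, hc⟩ := (isCompact_Icc (a := (0 : ℝ)) (b := 1)).prod hU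
    |>.exists_bound_of_continuousOn hg.continuousOn
  refine ⟨c, fun t => ?_⟩
  filter_upwards [measure_eq_zero_iff_ae_notMem.1 hl] with y hy
  exact hc (t, y) ⟨t.2, not_not.1 hy⟩

variable (hC : C.IsAdmissible Ω x)
include hC

/-- One functional `L` serves all tuples, as the integral depends on `T` only through its densities
at almost all times. Compactness of `U`, which carries the reference measure, bounds the continuous
function `g`. -/
lemma exists_pairing_component (k : Component G d) {U : Set (Pt d)} (hU : IsCompact U)
    (hk : C.ref k Uᶜ = 0) {g : ℝ → Pt d → ℝ} (hg : Continuous fun z : ℝ × Pt d => g z.1 z.2) :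
    ∃ L : Lp (DensitySpace C.ref) 2 (volume : Measure unitInterval) →L[ℝ] ℝ,
      ∀ T z, HasDensity C x T z →
        ∫ t : unitInterval, ∫ᵛ y, g t y ∂•(T.component x t k) = L z := by
  have := hC.isFiniteMeasure_ref
  obtain ⟨c, hc⟩ := exists_bound_of_continuous hU hg hk
  have hsm : StronglyMeasurable (Function.uncurry fun (t : unitInterval) y => g t y) :=
    (hg.comp (f := fun p : unitInterval × Pt d => ((p.1 : ℝ), p.2))
      (by fun_prop)).stronglyMeasurable
  obtain ⟨L, hL⟩ := DensitySpace.exists_pairing (l := C.ref) (ν := volume) k hsm hc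
  refine ⟨L, fun T z hz => ?_⟩
  rw [(hL z).2]
  refine integral_congr_ae ?_
  filter_upwards [hz] with t ht
  rw [ht, integral_withDensityᵥ_of_bound _ (integrable_Lp_two (z t k)) _ (hc t)]
  · simp
  · exact (hsm.comp_measurable measurable_prodMk_left).aestronglyMeasurable

lemma exists_pairing_J {U : Set (Pt d)} (hU : IsCompact U) (hl : C.lamBulk Uᶜ = 0)
    {g : ℝ → Pt d → Pt d} (hg : Continuous fun z : ℝ × Pt d => g z.1 z.2) :
    ∃ L : Lp (DensitySpace C.ref) 2 (volume : Measure unitInterval) →L[ℝ] ℝ,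
      ∀ T z, HasDensity C x T z →
        ∫ t : unitInterval, ∫ᵛ y, g t y ∂[innerSL ℝ; T.J t] = L z := by
  have := hC.isFiniteMeasure_ref
  obtain ⟨c, hc⟩ := exists_bound_of_continuous hU hg hl
  have hgu : Continuous (Function.uncurry fun (t : unitInterval) y => g t y) :=
    hg.comp (f := fun p : unitInterval × Pt d => ((p.1 : ℝ), p.2)) (by fun_prop)
  have hsm : ∀ i, StronglyMeasurable (Function.uncurry fun (t : unitInterval) y => g t y i) :=
    fun i => ((EuclideanSpace.proj i : Pt d →L[ℝ] ℝ).continuous.comp hgu).stronglyMeasurable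
  have hci : ∀ i, ∀ t : unitInterval, ∀ᵐ y ∂C.ref (.J i : Component G d), ‖g t y i‖ ≤ c := by
    intro i t
    filter_upwards [hc t] with y hy
    exact (PiLp.norm_apply_le _ i).trans hy
  choose L hL using fun i => DensitySpace.exists_pairing (l := C.ref) (ν := volume) (.J i) (hsm i)
    (hci i)
  -- The vector-valued pairing is the sum of the scalar pairings of the coordinates.
  refine ⟨∑ i, L i, fun T z hz => ?_⟩
  have hsum : (∑ i, L i) z = ∑ i, L i z := by simp
  rw [hsum]
  simp_rw [fun i => (hL i z).2]
  rw [← integral_finsetSum _ fun i _ => (hL i z).1]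
  refine integral_congr_ae ?_
  filter_upwards [hz] with t ht
  have hint : ∀ i, Integrable (z t (.J i)) C.lamBulk := fun i => integrable_Lp_two (z t (.J i))
  have hJ : T.J t = C.lamBulk.withDensityᵥ
      fun y => (WithLp.toLp 2 fun i => z t (.J i) y : Pt d) := by
    ext A hA i
    have h1 : T.J t A i = T.component x t (.J i) A := rfl
    rw [h1, ht, withDensityᵥ_apply (integrable_toLp hint) hA, setIntegral_toLp_apply hint,
      withDensityᵥ_apply (integrable_Lp_two (z t (.J i))) hA]
    rfl
  have hgt : Continuous (g t) := hgu.comp (Continuous.prodMk_right t)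
  rw [hJ, integral_withDensityᵥ_of_bound _ (integrable_toLp hint) hgt.aestronglyMeasurable (hc t)]
  simp only [CostData.ref]
  rw [← integral_finsetSum]
  · refine integral_congr_ae (Eventually.of_forall fun y => ?_)
    change ⟪g t y, (WithLp.toLp 2 fun i => z t (.J i) y : Pt d)⟫ = _
    simp [PiLp.inner_apply, mul_comm]
    rfl
  · intro i _
    exact (hint i).bdd_mul (hsm i |>.comp_measurable measurable_prodMk_left).aestronglyMeasurable
      (hci i t)

lemma exists_bulkFunctional (hΩ : IsCompact Ω) {φ : ℝ → Pt d → ℝ}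
    (hφ : ContDiff ℝ 1 fun z : ℝ × Pt d => φ z.1 z.2) :
    ∃ L : Lp (DensitySpace C.ref) 2 (volume : Measure unitInterval) →L[ℝ] ℝ,
      ∀ T z, HasDensity C x T z →
        (∫ t : unitInterval, ∫ᵛ y, deriv (fun r => φ r y) t ∂•(T.mu t))
          + (∫ t : unitInterval, ∫ᵛ y, ∇ (φ t) y ∂[innerSL ℝ; T.J t])
          - (∑ e : G.Edge, ∫ t : unitInterval, ∫ᵛ y, φ t y ∂•(T.f t e))
          + (∑ p : G.OuterEnd, ∫ t : unitInterval,
              ∫ᵛ _y, φ t (x p.vertex) * normal p.vertex p.edge ∂•(T.exchange t p)) = L z := by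
  have hseg : ∀ e : G.Edge, IsCompact (edgeSegment x e) := fun e => by
    rw [edgeSegment, segment_eq_image_lineMap]
    exact isCompact_Icc.image (by fun_prop)
  obtain ⟨Lmu, hmu⟩ := exists_pairing_component hC .mu hΩ hC.lamBulk_concentrated
    (g := fun t y => deriv (fun r => φ r y) t) (continuous_deriv_time hφ)
  obtain ⟨LJ, hJ⟩ := exists_pairing_J hC hΩ hC.lamBulk_concentrated
    (g := fun t => ∇ (φ t)) (continuous_gradient_space hφ)
  choose Lf hf using fun e => exists_pairing_component hC (.f e) (hseg e)
    (hC.lamEdge_concentrated e) hφ.continuous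
  choose Lx hx using fun p : G.OuterEnd => exists_pairing_component hC (.exchange p)
    isCompact_singleton (hC.lamVertex_concentrated p.vertex)
    (g := fun t _ => φ t (x p.vertex) * normal p.vertex p.edge)
    ((hφ.continuous.comp (f := fun z : ℝ × Pt d => (z.1, x p.vertex))
      (by fun_prop)).mul continuous_const)
  refine ⟨Lmu + LJ - ∑ e, Lf e + ∑ p, Lx p, fun T z hz => ?_⟩
  simp only [_root_.add_apply, _root_.sub_apply, _root_.sum_apply]
  rw [← hmu T z hz, ← hJ T z hz]
  simp_rw [← fun e => hf e T z hz, ← fun p => hx p T z hz]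
  rfl

lemma exists_graphFunctional {ψ : G.Edge → ℝ → ℝ → ℝ}
    (hψ : ∀ e, ContDiff ℝ 1 fun z : ℝ × ℝ => ψ e z.1 z.2) :
    ∃ L : Lp (DensitySpace C.ref) 2 (volume : Measure unitInterval) →L[ℝ] ℝ,
      ∀ T z, HasDensity C x T z →
        (∑ e : G.Edge,
          ((∫ t : unitInterval, ∫ᵛ y, deriv (fun r => ψ e r (coord x e y)) t ∂•(T.rho t e))
            + (∫ t : unitInterval,
                ∫ᵛ y, (G.len e)⁻¹ * deriv (ψ e t) (coord x e y) ∂•(T.flux t e))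
            + (∫ t : unitInterval, ∫ᵛ y, ψ e t (coord x e y) ∂•(T.f t e))))
          - (∑ p : G.OuterEnd, ∫ t : unitInterval,
              ∫ᵛ _y, ψ p.edge t (coord x p.edge (x p.vertex)) * normal p.vertex p.edge
                ∂•(T.exchange t p)) = L z := by
  have hseg : ∀ e : G.Edge, IsCompact (edgeSegment x e) := fun e => by
    rw [edgeSegment, segment_eq_image_lineMap]
    exact isCompact_Icc.image (by fun_prop)
  have hcoord : ∀ e : G.Edge, Continuous fun z : ℝ × Pt d => (z.1, coord x e z.2) := by
    intro e
    unfold coord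
    fun_prop
  choose Lr hr using fun e => exists_pairing_component hC (.rho e) (hseg e)
    (hC.lamEdge_concentrated e) (g := fun t y => deriv (fun r => ψ e r (coord x e y)) t)
    ((continuous_deriv_time (hψ e)).comp (hcoord e))
  choose Lv hv using fun e => exists_pairing_component hC (.flux e) (hseg e)
    (hC.lamEdge_concentrated e) (g := fun t y => (G.len e)⁻¹ * deriv (ψ e t) (coord x e y))
    (continuous_const.mul (((continuous_fderiv_space (hψ e)).comp (hcoord e)).clm_apply
      continuous_const))
  choose Lf hf using fun e => exists_pairing_component hC (.f e) (hseg e)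
    (hC.lamEdge_concentrated e) (g := fun t y => ψ e t (coord x e y))
    ((hψ e).continuous.comp (hcoord e))
  choose Lx hx using fun p : G.OuterEnd => exists_pairing_component hC (.exchange p)
    isCompact_singleton (hC.lamVertex_concentrated p.vertex)
    (g := fun t _ => ψ p.edge t (coord x p.edge (x p.vertex)) * normal p.vertex p.edge)
    (((hψ p.edge).continuous.comp
      (f := fun z : ℝ × Pt d => (z.1, coord x p.edge (x p.vertex))) (by fun_prop)).mul
      continuous_const)
  refine ⟨∑ e, (Lr e + Lv e + Lf e) - ∑ p, Lx p, fun T z hz => ?_⟩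
  simp only [_root_.add_apply, _root_.sub_apply, _root_.sum_apply]
  simp_rw [← fun e => hr e T z hz, ← fun e => hv e T z hz, ← fun e => hf e T z hz,
    ← fun p => hx p T z hz]
  rfl

/-- The densities of the weak solutions form a closed convex set. -/
lemma exists_closed_convex_densities (hΩ : IsCompact Ω) (μ₀ μ₁ : Measure (Pt d))
    (ρ₀ ρ₁ : G.Edge → Measure (Pt d)) :
    ∃ S : Set (Lp (DensitySpace C.ref) 2 (volume : Measure unitInterval)),
      IsClosed S ∧ Convex ℝ S ∧
      (∀ T ∈ CE G Ω x μ₀ μ₁ ρ₀ ρ₁, ∀ z, HasDensity C x T z → z ∈ S) ∧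
      ∀ z ∈ S, ∃ T ∈ CE G Ω x μ₀ μ₁ ρ₀ ρ₁, HasDensity C x T z := by
  obtain ⟨Lt, hLt⟩ := exists_traceConstraint hC
  choose Lb hLb using fun (φ : ℝ → Pt d → ℝ) hφ => exists_bulkFunctional hC hΩ (φ := φ) hφ
  choose Lg hLg using fun (ψ : G.Edge → ℝ → ℝ → ℝ) hψ => exists_graphFunctional hC (ψ := ψ) hψ
  refine ⟨{z | Lt z = 0}
    ∩ (⋂ (φ) (hφ), {z | Lb φ hφ z = (∫ y, φ 1 y ∂μ₁) - ∫ y, φ 0 y ∂μ₀})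
    ∩ (⋂ (ψ) (hψ) (_ : ∃ ψV : V → ℝ → ℝ, ∀ e, ∀ t ∈ Icc (0 : ℝ) 1,
        ψ e t 0 = ψV (src e) t ∧ ψ e t 1 = ψV (tgt e) t), {z | Lg ψ hψ z =
          ∑ e : G.Edge, ((∫ y, ψ e 1 (coord x e y) ∂(ρ₁ e)) - ∫ y, ψ e 0 (coord x e y) ∂(ρ₀ e))}),
    ?_, ?_, ?_, ?_⟩
  · refine ((isClosed_eq Lt.continuous continuous_const).inter
      (isClosed_iInter fun φ => isClosed_iInter fun hφ =>
        isClosed_eq (Lb φ hφ).continuous continuous_const)).inter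
      (isClosed_iInter fun ψ => isClosed_iInter fun hψ => isClosed_iInter fun _ =>
        isClosed_eq (Lg ψ hψ).continuous continuous_const)
  · refine ((convex_singleton (0 : G.OuterEnd → Lp ℝ 2 volume)).linear_preimage
      Lt.toLinearMap |>.inter (convex_iInter₂ fun φ hφ => ?_)).inter
      (convex_iInter₂ fun ψ hψ => convex_iInter fun _ => ?_)
    · exact (convex_singleton ((∫ y, φ 1 y ∂μ₁) - ∫ y, φ 0 y ∂μ₀)).linear_preimage
        (Lb φ hφ).toLinearMap
    · exact (convex_singleton (∑ e : G.Edge, ((∫ y, ψ e 1 (coord x e y) ∂(ρ₁ e))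
        - ∫ y, ψ e 0 (coord x e y) ∂(ρ₀ e)))).linear_preimage (Lg ψ hψ).toLinearMap
  · rintro T ⟨-, hb, hg⟩ z hz
    refine ⟨⟨(hLt z).2 (trace_of_component hC hz), ?_⟩, ?_⟩
    · simp only [mem_iInter]
      exact fun φ hφ => (hLb φ hφ T z hz).symm.trans (hb φ hφ)
    · simp only [mem_iInter]
      exact fun ψ hψ hV => (hLg ψ hψ T z hz).symm.trans (hg ψ hψ hV)
  · rintro z ⟨⟨ht, hb⟩, hg⟩
    simp only [mem_iInter] at hb hg
    -- The constraint `Lt z = 0` is what makes the trace densities in `z` those of the constructed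
    -- tuple.
    have hz : HasDensity C x (Tuple.ofDensity C fun t k => z t k) z :=
      component_ofDensity_ae hC z ((hLt z).1 ht)
    exact ⟨_, ⟨isAdmissibleTuple_ofDensity hC z, fun φ hφ => (hLb φ hφ _ z hz).trans (hb φ hφ),
      fun ψ hψ hV => (hLg ψ hψ _ z hz).trans (hg ψ hψ hV)⟩, hz⟩

end Equations

end

/-! ### Existence of a minimizing tuple. -/

theorem mainTheorem1 {V : Type*} [Finite V] {d : ℕ}
    (Ω : Set (Pt d)) (hΩ_compact : IsCompact Ω) (hΩ_convex : Convex ℝ Ω)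
    (G : MetricGraph V) (x : V → Pt d) (hx : G.IsEmbedded Ω x)
    (C : CostData G d) (hC : C.IsAdmissible Ω x)
    (μ₀ μ₁ : Measure (Pt d)) (ρ₀ ρ₁ : G.Edge → Measure (Pt d))
    (h₀ : IsAdmissibleData Ω x μ₀ ρ₀) (h₁ : IsAdmissibleData Ω x μ₁ ρ₁)
    (hfin : valueBB G C Ω x μ₀ μ₁ ρ₀ ρ₁ < ⊤) :
    ∃ T ∈ CE G Ω x μ₀ μ₁ ρ₀ ρ₁, totalAction C x T = valueBB G C Ω x μ₀ μ₁ ρ₀ ρ₁ := by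
  have := hC.isFiniteMeasure_ref
  obtain ⟨S, hScl, hSc, hS₁, hS₂⟩ :=
    exists_closed_convex_densities hC hΩ_compact μ₀ μ₁ ρ₀ ρ₁
  have hlsc := lowerSemicontinuous_actionFunctional hC
  obtain ⟨T₀, hT₀⟩ := iInf_lt_iff.1 hfin
  obtain ⟨hT₀, hT₀fin⟩ := iInf_lt_iff.1 hT₀
  obtain ⟨z₀, hz₀, hz₀'⟩ := exists_density_of_totalAction_lt_top hC hT₀.1 hT₀fin
  obtain ⟨z, hzS, hz⟩ := exists_minimizer hScl hSc
    (F := fun z => ∫⁻ t, actionFunctional C (z t))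
    (lowerSemicontinuous_lintegral_Lp hlsc)
    (ENNRealConvex.lintegral_Lp hlsc (convex_actionFunctional hC))
    (QuadraticGrowth.lintegral_Lp hlsc (quadraticGrowth_actionFunctional hC))
    ⟨z₀, hS₁ T₀ hT₀ z₀ hz₀, by rwa [hz₀']⟩
  obtain ⟨T, hT, hTz⟩ := hS₂ z hzS
  refine ⟨T, hT, le_antisymm (le_iInf₂ fun T' hT' => ?_) (iInf₂_le T hT)⟩
  -- Competitors of infinite action lose trivially; all others have densities in `S`, where `z` is
  -- minimal.
  rcases eq_or_ne (totalAction C x T') ⊤ with h | h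
  · rw [h]
    exact le_top
  · obtain ⟨z', hz', hz''⟩ := exists_density_of_totalAction_lt_top hC hT'.1 (lt_top_iff_ne_top.2 h)
    rw [totalAction_eq_of_component hC hTz, ← hz'']
    exact hz z' (hS₁ T' hT' z' hz')
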